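/- **Setting.** Let $d,n$ be positive integers and $\mathbf{x}^1,\dots,\mathbf{x}^n\in\mathbb{R}^d$. Let $p$ be a probability density function on $\mathbb{R}$ with non-negative support, and let $f:\mathbb{R}\to\mathbb{R}$ be a (measurable) even function supported on $[-1/2,1/2]$ with $\|f\|_2=1$. Write $f^{\otimes d}(\mathbf{x})=\prod_{l=1}^d f(x_l)$ and let $\|\cdot\|_\infty$ be the $L^\infty$ norm with respect to Lebesgue measure. *WLSH kernel.* $k_{f,p}(\mathbf{x})=\prod_{l=1}^d\int_0^\infty p(w)\,(f*f)(x_l/w)\,dw$, with kernel matrix $K\in\mathbb{R}^{n\times n}$, $K_{ij}=k_{f,p}(\mathbf{x}^i-\mathbf{x}^j)$. *WLSH estimator.* Let $\mathbf{w}\in\mathbb{R}^d$ have i.i.d. entries with density $p$ and, given $\mathbf{w}$, let $\mathbf{z}$ be uniform on $[0,w_1]\times\dots\times[0,w_d]$. Put $h(\mathbf{x})_l=\mathrm{round}\big((x_l-z_l)/w_l\big)$ for $l=1,\dots,d$. The estimator is $$\widetilde k(\mathbf{x},\mathbf{y})=f^{\otimes d}\Big(h(\mathbf{x})+\tfrac{\mathbf{z}-\mathbf{x}}{\mathbf{w}}\Big)\,f^{\otimes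 d}\Big(h(\mathbf{y})+\tfrac{\mathbf{z}-\mathbf{y}}{\mathbf{w}}\Big)\quad\text{if } h(\mathbf{x})=h(\mathbf{y}),$$ and $\widetilde k(\mathbf{x},\mathbf{y})=0$ otherwise (division of vectors is entrywise). Its kernel matrix is $\big(\widetilde k(\mathbf{x}^i,\mathbf{x}^j)\big)_{i,j}$. *Oblivious subspace embedding.* For $\varepsilon,\delta,\lambda>0$, a probability distribution over $n\times n$ matrices $\widetilde K$ is an $(\varepsilon,\delta,\lambda)$-oblivious subspace embedding for a positive semi-definite matrix $K$ if, with probability at least $1-\delta$, $$(1-\varepsilon)(K+\lambda I)\preceq \widetilde K+\lambda I\preceq(1+\varepsilon)(K+\lambda I).$$ **Theorem.** For every integer $c\ge 0$ and every $\varepsilon_0>0$ there is a constant $C>0$, depending only on $c$ and $\varepsilon_0$, such that the following holds for all $d,n,\mathbf{x}^1,\dots,\mathbf{x}^n,p,f$ as above, all $\lambda>0$, all $0<\varepsilon\le\varepsilon_0$ and all integers $m\ge1$ with $$m\;\ge\; C\,\frac{\|f^{\otimes d}\|_\infty^2}{\varepsilon^2}\cdot\frac{n}{\lambda}\cdot\log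 n .$$ Let $\widetilde K^1,\dots,\widetilde K^m$ be the kernel matrices of $m$ independent instances of the WLSH estimator. Then the WLSH kernel matrix $K$ is positive semi-definite, and the distribution of $\widetilde K=\frac1m\sum_{s=1}^m\widetilde K^s$ is an $(\varepsilon,n^{-c},\lambda)$-oblivious subspace embedding for $K$. -/

import Mathlib

open MeasureTheory ProbabilityTheory
open scoped ENNReal Matrix

noncomputable section

namespace WLSH

/-- `p` is a probability density function on `ℝ` with non-negative support. -/
structure IsNonnegPDF (p : ℝ → ℝ) : Prop where
  measurable : Measurable p
  nonneg : ∀ w, 0 ≤ p w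
  support_subset : Function.support p ⊆ Set.Ici 0
  lintegral_eq_one : ∫⁻ w, ENNReal.ofReal (p w) = 1

/-- `f` is an even function supported on `[-1/2, 1/2]` with unit `L²` norm. -/
structure IsBucketShape (f : ℝ → ℝ) : Prop where
  measurable : Measurable f
  even : Function.Even f
  support_subset : Function.support f ⊆ Set.Icc (-1 / 2) (1 / 2)
  norm_eq_one : eLpNorm f 2 volume = 1

/-- The tensor power `f^{⊗ d}(x) = ∏ l, f (x l)`. -/
def tensorPower (f : ℝ → ℝ) (d : ℕ) (x : Fin d → ℝ) : ℝ := ∏ l, f (x l)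

/-- The hash function `h_{w,z}`, rounding `(x l - z l) / w l` to a nearest integer. -/
def hash {d : ℕ} (w z x : Fin d → ℝ) : Fin d → ℤ := fun l => round ((x l - z l) / w l)

/-- The law of `w`: its entries are i.i.d. with density `p`. -/
def widthLaw (p : ℝ → ℝ) (d : ℕ) : Measure (Fin d → ℝ) :=
  Measure.pi fun _ => volume.withDensity fun t => ENNReal.ofReal (p t)

/-- The conditional law of `z` given `w`: uniform on the box
`[0, w] = [0, w 0] × ⋯ × [0, w (d - 1)]`.
(It is the zero measure if the box has volume zero.) -/
def uniformBox (d : ℕ) : Kernel (Fin d → ℝ) (Fin d → ℝ) where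
  toFun w := ProbabilityTheory.cond volume (Set.Icc 0 w)
  measurable' := by
    have key : ∀ s : Set (Fin d → ℝ), MeasurableSet s →
        Measurable fun w : Fin d → ℝ => volume (Set.Icc 0 w ∩ s) := by
      intro s hs
      have hE : MeasurableSet {q : (Fin d → ℝ) × (Fin d → ℝ) | (0 ≤ q.2 ∧ q.2 ≤ q.1) ∧ q.2 ∈ s} :=
        (((measurableSet_le measurable_const measurable_snd).inter
          (measurableSet_le measurable_snd measurable_fst))).inter (measurable_snd hs)
      exact measurable_measure_prodMk_left hE
    refine Measure.measurable_of_measurable_coe _ fun s hs => ?_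
    simp only [ProbabilityTheory.cond_apply measurableSet_Icc]
    refine Measurable.mul (Measurable.inv ?_) (key s hs)
    simpa using key Set.univ MeasurableSet.univ

instance (d : ℕ) : IsFiniteKernel (uniformBox d) where
  exists_univ_le := by
    refine ⟨1, ENNReal.one_lt_top, fun w => ?_⟩
    change ProbabilityTheory.cond volume (Set.Icc 0 w) Set.univ ≤ 1
    rw [ProbabilityTheory.cond_apply measurableSet_Icc, Set.inter_univ]
    exact ENNReal.inv_mul_le_one _

/-- The joint law of the parameters `(w, z)` of a random hash function of the LSH family. -/
def lshLaw (p : ℝ → ℝ) (d : ℕ) : Measure ((Fin d → ℝ) × (Fin d → ℝ)) :=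
  widthLaw p d ⊗ₘ uniformBox d

/-- The WLSH estimator with bucket-shaping function `f` and hash parameters `θ = (w, z)`. -/
def estimator {d : ℕ} (f : ℝ → ℝ) (θ : (Fin d → ℝ) × (Fin d → ℝ)) (x y : Fin d → ℝ) : ℝ :=
  if hash θ.1 θ.2 x = hash θ.1 θ.2 y then
    tensorPower f d (fun l => (hash θ.1 θ.2 x l : ℝ) + (θ.2 l - x l) / θ.1 l) *
      tensorPower f d (fun l => (hash θ.1 θ.2 y l : ℝ) + (θ.2 l - y l) / θ.1 l)
  else 0

/-- The kernel matrix of the WLSH estimator with hash parameters `θ` on the points `x`. -/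
def estimatorMatrix {d n : ℕ} (f : ℝ → ℝ) (x : Fin n → Fin d → ℝ)
    (θ : (Fin d → ℝ) × (Fin d → ℝ)) : Matrix (Fin n) (Fin n) ℝ :=
  Matrix.of fun i j => estimator f θ (x i) (x j)

/-- The WLSH kernel `k_{f,p}(x) = ∏ l, ∫₀^∞ p(w) (f * f)(x l / w) dw`. -/
def kernel {d : ℕ} (f p : ℝ → ℝ) (x : Fin d → ℝ) : ℝ :=
  ∏ l, ∫ w in Set.Ioi (0 : ℝ),
    p w * convolution f f (ContinuousLinearMap.mul ℝ ℝ) volume (x l / w)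

/-- The kernel matrix `K i j = k_{f,p}(x i - x j)`. -/
def kernelMatrix {d n : ℕ} (f p : ℝ → ℝ) (x : Fin n → Fin d → ℝ) :
    Matrix (Fin n) (Fin n) ℝ :=
  Matrix.of fun i j => kernel f p (x i - x j)

/-- Real matrices carry the product (equivalently, Borel) `σ`-algebra of their entries. -/
instance instMeasurableSpaceMatrix (n : ℕ) : MeasurableSpace (Matrix (Fin n) (Fin n) ℝ) :=
  inferInstanceAs (MeasurableSpace (Fin n → Fin n → ℝ))

/-- The Loewner order `A ⪯ B`. -/
def LoewnerLE {n : ℕ} (A B : Matrix (Fin n) (Fin n) ℝ) : Prop := (B - A).PosSemidef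

/-- The probability distribution `D` on `n × n` matrices is an `(ε, δ, lam)`-oblivious subspace
embedding for the positive semi-definite matrix `K`. -/
structure IsOSE {n : ℕ} (ε δ lam : ℝ) (K : Matrix (Fin n) (Fin n) ℝ)
    (D : Measure (Matrix (Fin n) (Fin n) ℝ)) : Prop where
  posSemidef : K.PosSemidef
  isProbabilityMeasure : IsProbabilityMeasure D
  embedding : ENNReal.ofReal (1 - δ) ≤ D {M |
    LoewnerLE ((1 - ε) • (K + lam • (1 : Matrix (Fin n) (Fin n) ℝ))) (M + lam • 1) ∧
    LoewnerLE (M + lam • 1) ((1 + ε) • (K + lam • (1 : Matrix (Fin n) (Fin n) ℝ)))}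

end WLSH

end

/-! For fixed widths, an instance of the estimator is a product over coordinates of functions
periodic in the shift, so averaging over the shift gives `f * f` in each coordinate and its mean is
`K`. One instance is a sum over buckets of rank-one matrices `v vᵀ`; its entries are a.s. at most `F
^ 2` with `F = ‖f^{⊗d}‖_∞`, whence `0 ⪯ K̃ˢ ⪯ n F² I`.

Write `K + λI = BᴴB` and `D = B⁻¹`. The embedding says that the average of the whitened matrices `X
= Dᴴ K̃ˢ D` is within `ε` of its mean `M = Dᴴ K D` in the Loewner order. Here `0 ⪯ X ⪯ R I` as soon
as `R ≥ n F² / λ`, and `M ⪯ I`.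

It remains to prove a matrix Bernstein bound (`Matrix.measureReal_deviation_le`), by the
Ahlswede–Winter method: Markov's inequality for the trace of the exponential, with the
Golden–Thompson inequality `tr e^(A+B) ≤ tr (e^A e^B)` splitting off one independent summand at a
time. Each summand costs `E e^(κ(X-M)) ⪯ (1 + κ²R) I`, from `e^Y ⪯ 1 + Y + Y²` and `X² ⪯ R X`.
Golden–Thompson itself comes from the Lie product formula and a trace inequality for powers `2 ^ k`.
-/

/-! ### The Lie product formula. -/

section LieProduct

open Filter Topology NormedSpace

theorem HasDerivAt.tendsto_nat_smul_sub {E : Type*} [NormedAddCommGroup E] [NormedSpace ℝ E]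
    {f : ℝ → E} {D : E} (hf : HasDerivAt f D 0) :
    Tendsto (fun k : ℕ => (k : ℝ) • (f (k : ℝ)⁻¹ - f 0)) atTop (𝓝 D) := by
  have h := hf.tendsto_slope_zero_right
  have h1 : Tendsto (fun k : ℕ => (k : ℝ)⁻¹) atTop (𝓝[>] 0) :=
    tendsto_inv_atTop_nhdsGT_zero.comp tendsto_natCast_atTop_atTop
  refine (h.comp h1).congr fun k => ?_
  simp

variable {𝔸 : Type*} [NormedRing 𝔸] [NormOneClass 𝔸]

theorem norm_pow_sub_pow_le {x y : 𝔸} {M : ℝ} (hx : ‖x‖ ≤ M) (hy : ‖y‖ ≤ M) (hM : 1 ≤ M) (k : ℕ) :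
    ‖x ^ k - y ^ k‖ ≤ k * M ^ k * ‖x - y‖ := by
  induction k with
  | zero => simp
  | succ k ih =>
    have hM0 : 0 ≤ M := zero_le_one.trans hM
    have h1 : ‖x ^ k * (x - y)‖ ≤ M ^ (k + 1) * ‖x - y‖ :=
      (norm_mul_le _ _).trans (mul_le_mul_of_nonneg_right
        (((norm_pow_le x k).trans (pow_le_pow_left₀ (norm_nonneg _) hx k)).trans
          (pow_le_pow_right₀ hM k.le_succ)) (norm_nonneg _))
    have h2 : ‖(x ^ k - y ^ k) * y‖ ≤ k * M ^ k * ‖x - y‖ * M :=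
      (norm_mul_le _ _).trans (mul_le_mul ih hy (norm_nonneg _) (by positivity))
    calc ‖x ^ (k + 1) - y ^ (k + 1)‖ = ‖x ^ k * (x - y) + (x ^ k - y ^ k) * y‖ := by
          congr 1; rw [pow_succ, pow_succ]; noncomm_ring
      _ ≤ M ^ (k + 1) * ‖x - y‖ + k * M ^ k * ‖x - y‖ * M := (norm_add_le _ _).trans (add_le_add h1 h2)
      _ = (k + 1 : ℕ) * M ^ (k + 1) * ‖x - y‖ := by push_cast; ring

variable [NormedAlgebra ℝ 𝔸]

/-- Both sequences are `1 + D/k + o(1/k)`. Norms at most `1 + (‖D‖ + 1)/k` keep the `k`-th powers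
below `e^(‖D‖ + 1)`, so the difference of powers is controlled by `k ‖u k - v k‖ → 0`. -/
theorem tendsto_pow_sub_pow_zero {u v : ℕ → 𝔸} {D : 𝔸}
    (hu : Tendsto (fun k : ℕ => (k : ℝ) • (u k - 1)) atTop (𝓝 D))
    (hv : Tendsto (fun k : ℕ => (k : ℝ) • (v k - 1)) atTop (𝓝 D)) :
    Tendsto (fun k => u k ^ k - v k ^ k) atTop (𝓝 0) := by
  have bound : ∀ w : ℕ → 𝔸, Tendsto (fun k : ℕ => (k : ℝ) • (w k - 1)) atTop (𝓝 D) →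
      ∀ᶠ k : ℕ in atTop, ‖w k‖ ≤ 1 + (‖D‖ + 1) / k := by
    intro w hw
    filter_upwards [hw.norm.eventually_lt_const (lt_add_one ‖D‖), eventually_gt_atTop 0] with k hk h0
    have hk0 : (0 : ℝ) < k := by exact_mod_cast h0
    rw [norm_smul, Real.norm_of_nonneg hk0.le] at hk
    have h3 : ‖w k - 1‖ ≤ (‖D‖ + 1) / k := by rw [le_div_iff₀ hk0]; linarith
    calc ‖w k‖ = ‖1 + (w k - 1)‖ := by congr 1; abel
      _ ≤ 1 + (‖D‖ + 1) / k := (norm_add_le _ _).trans (by rw [norm_one]; linarith)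
  have hdiff : Tendsto (fun k : ℕ => Real.exp (‖D‖ + 1) * ‖(k : ℝ) • (u k - v k)‖) atTop (𝓝 0) := by
    have h := ((hu.sub hv).norm.const_mul (Real.exp (‖D‖ + 1)))
    simp only [sub_self, norm_zero, mul_zero] at h
    refine h.congr fun k => ?_
    rw [← smul_sub]; congr 3; abel
  refine squeeze_zero_norm' ?_ hdiff
  filter_upwards [bound u hu, bound v hv, eventually_gt_atTop 0] with k h1 h2 h0
  have hk0 : (0 : ℝ) < k := by exact_mod_cast h0
  refine (norm_pow_sub_pow_le h1 h2 (by linarith [show 0 ≤ (‖D‖ + 1) / k by positivity]) k).trans ?_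
  have h4 : (1 + (‖D‖ + 1) / k) ^ k ≤ Real.exp (‖D‖ + 1) := by
    calc (1 + (‖D‖ + 1) / (k : ℝ)) ^ k ≤ Real.exp ((‖D‖ + 1) / k) ^ k := by
          refine pow_le_pow_left₀ (by positivity) ?_ k
          rw [add_comm]; exact Real.add_one_le_exp _
      _ = Real.exp (‖D‖ + 1) := by rw [← Real.exp_nat_mul]; congr 1; field_simp
  rw [norm_smul, Real.norm_of_nonneg hk0.le]
  calc (k : ℝ) * (1 + (‖D‖ + 1) / k) ^ k * ‖u k - v k‖
      = (1 + (‖D‖ + 1) / k) ^ k * (k * ‖u k - v k‖) := by ring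
    _ ≤ _ := mul_le_mul_of_nonneg_right h4 (by positivity)

/-- The **Lie product formula**. -/
theorem tendsto_exp_mul_exp_pow [CompleteSpace 𝔸] (a b : 𝔸) :
    Tendsto (fun k : ℕ => (exp ((k : ℝ)⁻¹ • a) * exp ((k : ℝ)⁻¹ • b)) ^ k) atTop
      (𝓝 (exp (a + b))) := by
  let _ : NormedAlgebra ℚ 𝔸 := NormedAlgebra.restrictScalars ℚ ℝ 𝔸
  have hd : ∀ c : 𝔸, HasDerivAt (fun t : ℝ => exp (t • c)) c 0 := fun c => by
    simpa using hasDerivAt_exp_smul_const (𝕂 := ℝ) c (0 : ℝ)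
  have hu : Tendsto (fun k : ℕ => (k : ℝ) • (exp ((k : ℝ)⁻¹ • a) * exp ((k : ℝ)⁻¹ • b) - 1)) atTop
      (𝓝 (a + b)) := by
    have h := ((hd a).mul (hd b)).tendsto_nat_smul_sub
    simpa using h
  have hv : Tendsto (fun k : ℕ => (k : ℝ) • (exp ((k : ℝ)⁻¹ • (a + b)) - 1)) atTop
      (𝓝 (a + b)) := by
    have h := (hd (a + b)).tendsto_nat_smul_sub
    simpa using h
  have h := (tendsto_pow_sub_pow_zero hu hv).add_const (exp (a + b))
  rw [zero_add] at h
  refine h.congr' ?_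
  filter_upwards [eventually_gt_atTop 0] with k h0
  have hk0 : (k : ℝ) ≠ 0 := by exact_mod_cast h0.ne'
  have h5 : exp ((k : ℝ)⁻¹ • (a + b)) ^ k = exp (a + b) := by
    rw [← exp_nsmul, ← Nat.cast_smul_eq_nsmul ℝ, smul_smul, mul_inv_cancel₀ hk0, one_smul]
  rw [h5, sub_add_cancel]

end LieProduct

/-! ### Trace inequalities and Golden–Thompson. -/

namespace Matrix

variable {ι : Type*} [Fintype ι]

theorem trace_mul_self_le_trace_mul_transpose (X : Matrix ι ι ℝ) :
    (X * X).trace ≤ (X * Xᵀ).trace := by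
  have h := (posSemidef_self_mul_conjTranspose (X - Xᵀ)).trace_nonneg
  have h1 : (Xᵀ * Xᵀ).trace = (X * X).trace := by rw [← transpose_mul, trace_transpose]
  have h2 : (Xᵀ * X).trace = (X * Xᵀ).trace := trace_mul_comm _ _
  simp only [conjTranspose_eq_transpose_of_trivial, transpose_sub, transpose_transpose, sub_mul,
    mul_sub, trace_sub] at h
  linarith

theorem two_mul_trace_mul_le {P Q : Matrix ι ι ℝ} (hP : P.IsSymm) (hQ : Q.IsSymm) :
    2 * (P * Q).trace ≤ (P * P).trace + (Q * Q).trace := by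
  have h := (posSemidef_self_mul_conjTranspose (P - Q)).trace_nonneg
  have h2 : (Q * P).trace = (P * Q).trace := trace_mul_comm _ _
  simp only [conjTranspose_eq_transpose_of_trivial, transpose_sub, hP.eq, hQ.eq, sub_mul,
    mul_sub, trace_sub] at h
  linarith

variable [DecidableEq ι]

theorem trace_mul_pow_comm {R : Type*} [CommRing R] (A B : Matrix ι ι R) (k : ℕ) :
    ((A * B) ^ k).trace = ((B * A) ^ k).trace := by
  cases k with
  | zero => simp
  | succ k =>
    have h : ∀ k : ℕ, (A * B) ^ k * A = A * (B * A) ^ k := fun k => by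
      induction k with
      | zero => simp
      | succ k ih => rw [pow_succ', mul_assoc, ih, pow_succ']; simp only [mul_assoc]
    rw [pow_succ, ← mul_assoc, h, mul_assoc, trace_mul_comm, mul_assoc, ← pow_succ]

theorem IsSymm.pow_real {P : Matrix ι ι ℝ} (hP : P.IsSymm) (k : ℕ) : (P ^ k).IsSymm := by
  rw [IsSymm, transpose_pow, hP.eq]

/-- The two bounds feed each other. The first at level `k + 1` applies level `k` to `X * X`, cycles
the trace to reach powers of `(X Xᵀ)(Xᵀ X)`, and separates these by the second. The second applies
the first to `X = P Q` and cycles to `(Q² P²) ^ 2 ^ k`. -/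
theorem trace_pow_two_pow_le (k : ℕ) :
    (∀ X : Matrix ι ι ℝ, (X ^ 2 ^ (k + 1)).trace ≤ ((X * Xᵀ) ^ 2 ^ k).trace) ∧
    ∀ P Q : Matrix ι ι ℝ, P.IsSymm → Q.IsSymm →
      ((P * Q) ^ 2 ^ k).trace ≤ (P ^ 2 ^ k * Q ^ 2 ^ k).trace := by
  induction k with
  | zero =>
    refine ⟨fun X => ?_, fun P Q _ _ => by simp⟩
    simpa [pow_two] using trace_mul_self_le_trace_mul_transpose X
  | succ k ih =>
    obtain ⟨hA, hB⟩ := ih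
    refine ⟨fun X => ?_, fun P Q hP hQ => ?_⟩
    · have e : ∀ Y : Matrix ι ι ℝ, Y ^ 2 ^ k * Y ^ 2 ^ k = Y ^ 2 ^ (k + 1) := fun Y => by
        rw [← pow_add]; congr 1; ring
      calc (X ^ 2 ^ (k + 1 + 1)).trace = ((X * X) ^ 2 ^ (k + 1)).trace := by
            rw [← pow_two, ← pow_mul]; congr 2; ring
        _ ≤ (((X * X) * (X * X)ᵀ) ^ 2 ^ k).trace := hA _
        _ = ((X * (X * Xᵀ * Xᵀ)) ^ 2 ^ k).trace := by simp only [transpose_mul, mul_assoc]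
        _ = (((X * Xᵀ) * (Xᵀ * X)) ^ 2 ^ k).trace := by
            rw [trace_mul_pow_comm]; simp only [mul_assoc]
        _ ≤ ((X * Xᵀ) ^ 2 ^ k * (Xᵀ * X) ^ 2 ^ k).trace :=
            hB _ _ (isSymm_mul_transpose_self X) (isSymm_transpose_mul_self X)
        _ ≤ ((X * Xᵀ) ^ 2 ^ (k + 1)).trace := by
            -- The squares of the two factors have equal trace, since `X Xᵀ` and `Xᵀ X` have the
            -- same power traces.
            have h := two_mul_trace_mul_le ((isSymm_mul_transpose_self X).pow_real (2 ^ k))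
              ((isSymm_transpose_mul_self X).pow_real (2 ^ k))
            rw [e, e, trace_mul_pow_comm Xᵀ X] at h
            linarith
    · calc ((P * Q) ^ 2 ^ (k + 1)).trace ≤ (((P * Q) * (P * Q)ᵀ) ^ 2 ^ k).trace := hA _
        _ = ((P * (Q * Q * P)) ^ 2 ^ k).trace := by
            simp only [transpose_mul, hP.eq, hQ.eq, mul_assoc]
        _ = (((Q ^ 2) * (P ^ 2)) ^ 2 ^ k).trace := by
            rw [trace_mul_pow_comm]; simp only [pow_two, mul_assoc]
        _ ≤ ((Q ^ 2) ^ 2 ^ k * (P ^ 2) ^ 2 ^ k).trace := hB _ _ (hQ.pow_real 2) (hP.pow_real 2)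
        _ = (P ^ 2 ^ (k + 1) * Q ^ 2 ^ (k + 1)).trace := by
            rw [trace_mul_comm, ← pow_mul, ← pow_mul, pow_succ' 2 k]

open scoped Matrix.Norms.L2Operator in
theorem tendsto_exp_smul_mul_exp_smul_pow (A B : Matrix ι ι ℝ) :
    Filter.Tendsto (fun k : ℕ => (NormedSpace.exp ((k : ℝ)⁻¹ • A) *
      NormedSpace.exp ((k : ℝ)⁻¹ • B)) ^ k) Filter.atTop
      (nhds (NormedSpace.exp (A + B))) := by
  -- For empty `ι` the identity has norm `0`, so `NormOneClass` fails.
  cases isEmpty_or_nonempty ι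
  · exact tendsto_const_nhds.congr fun k => Subsingleton.elim _ _
  · exact _root_.tendsto_exp_mul_exp_pow A B

/-- The **Golden–Thompson inequality** for real symmetric matrices. -/
theorem trace_exp_add_le {A B : Matrix ι ι ℝ} (hA : A.IsSymm) (hB : B.IsSymm) :
    (NormedSpace.exp (A + B)).trace ≤ (NormedSpace.exp A * NormedSpace.exp B).trace := by
  have h1 : Filter.Tendsto (fun k : ℕ => 2 ^ k) Filter.atTop Filter.atTop :=
    tendsto_pow_atTop_atTop_of_one_lt one_lt_two
  have h := ((continuous_id.matrix_trace (R := ℝ)).tendsto _).comp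
    ((tendsto_exp_smul_mul_exp_smul_pow A B).comp h1)
  refine le_of_tendsto h (Filter.Eventually.of_forall fun k => ?_)
  have e : ∀ C : Matrix ι ι ℝ,
      NormedSpace.exp (((2 ^ k : ℕ) : ℝ)⁻¹ • C) ^ 2 ^ k = NormedSpace.exp C := fun C => by
    rw [← exp_nsmul, ← Nat.cast_smul_eq_nsmul ℝ, smul_smul, mul_inv_cancel₀ (by positivity),
      one_smul]
  refine ((trace_pow_two_pow_le k).2 _ _ (hA.smul _).exp (hB.smul _).exp).trans_eq ?_
  rw [e, e]

end Matrix

namespace Matrix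

/-! ### Spectral calculus for real symmetric matrices. -/

section Spectral

variable {ι : Type*} [Fintype ι] [DecidableEq ι]

theorem IsHermitian.exists_conj_diagonal {A : Matrix ι ι ℝ} (hA : A.IsHermitian) :
    ∃ (U : Matrix ι ι ℝ) (D : ι → ℝ), Uᴴ * U = 1 ∧ U * Uᴴ = 1 ∧ A = U * diagonal D * Uᴴ := by
  refine ⟨hA.eigenvectorUnitary, hA.eigenvalues, ?_, ?_, ?_⟩
  · exact Unitary.coe_star_mul_self hA.eigenvectorUnitary
  · exact Unitary.coe_mul_star_self hA.eigenvectorUnitary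
  · have h := hA.spectral_theorem
    rw [Unitary.conjStarAlgAut_apply] at h
    exact h

theorem exp_conj_diagonal {U : Matrix ι ι ℝ} (hU : U * Uᴴ = 1) (D : ι → ℝ) :
    NormedSpace.exp (U * diagonal D * Uᴴ) = U * diagonal (fun i => Real.exp (D i)) * Uᴴ := by
  have hinv : U⁻¹ = Uᴴ := inv_eq_right_inv hU
  have hu : IsUnit U := (isUnit_iff_isUnit_det U).2 (isUnit_det_of_right_inverse hU)
  rw [← hinv, exp_conj U _ hu, exp_diagonal, Real.exp_eq_exp_ℝ]
  congr 3
  ext i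
  exact Pi.coe_exp _ _

theorem trace_conj_of_mul_eq_one {U : Matrix ι ι ℝ} (hU : Uᴴ * U = 1) (B : Matrix ι ι ℝ) :
    (U * B * Uᴴ).trace = B.trace := by
  rw [trace_mul_comm, ← mul_assoc, hU, one_mul]

theorem posSemidef_exp {A : Matrix ι ι ℝ} (hA : A.IsHermitian) :
    (NormedSpace.exp A).PosSemidef := by
  obtain ⟨U, D, -, hU, rfl⟩ := hA.exists_conj_diagonal
  rw [exp_conj_diagonal hU]
  exact (PosSemidef.diagonal fun i => (Real.exp_pos _).le).mul_mul_conjTranspose_same U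

theorem posSemidef_conj_diagonal_iff {U : Matrix ι ι ℝ} (hU : Uᴴ * U = 1) {D : ι → ℝ} :
    (U * diagonal D * Uᴴ).PosSemidef ↔ ∀ i, 0 ≤ D i := by
  rw [← posSemidef_diagonal_iff]
  refine ⟨fun h => ?_, fun h => h.mul_mul_conjTranspose_same U⟩
  have h1 := h.conjTranspose_mul_mul_same U
  have e : Uᴴ * (U * diagonal D * Uᴴ) * U = (Uᴴ * U) * diagonal D * (Uᴴ * U) := by
    simp only [mul_assoc]
  rwa [e, hU, one_mul, mul_one] at h1

/-- After diagonalization this is `e^x ≤ 1 + x + x²` on `[-1, 1]`, where the eigenvalues lie. -/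
theorem posSemidef_one_add_add_sq_sub_exp {A : Matrix ι ι ℝ} (h₁ : (1 - A).PosSemidef)
    (h₂ : (1 + A).PosSemidef) : (1 + A + A * A - NormedSpace.exp A).PosSemidef := by
  have hA : A.IsHermitian := by
    have h := isHermitian_one.sub h₁.1
    rwa [sub_sub_cancel] at h
  obtain ⟨U, D, hU', hU, rfl⟩ := hA.exists_conj_diagonal
  have e1 : (1 : Matrix ι ι ℝ) = U * diagonal (fun _ => 1) * Uᴴ := by
    rw [diagonal_one, mul_one, hU]
  have e2 : U * diagonal D * Uᴴ * (U * diagonal D * Uᴴ) = U * diagonal (fun i => D i * D i) * Uᴴ := by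
    calc U * diagonal D * Uᴴ * (U * diagonal D * Uᴴ)
        = U * diagonal D * (Uᴴ * U) * diagonal D * Uᴴ := by simp only [mul_assoc]
      _ = _ := by rw [hU', mul_one, mul_assoc U, diagonal_mul_diagonal]
  rw [e1, ← sub_mul, ← mul_sub, diagonal_sub, posSemidef_conj_diagonal_iff hU'] at h₁
  rw [e1, ← add_mul, ← mul_add, diagonal_add, posSemidef_conj_diagonal_iff hU'] at h₂
  rw [exp_conj_diagonal hU, e2, e1, ← add_mul, ← mul_add, diagonal_add, ← add_mul, ← mul_add,
    diagonal_add, ← sub_mul, ← mul_sub, diagonal_sub, posSemidef_conj_diagonal_iff hU']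
  intro i
  have h := Real.abs_exp_sub_one_sub_id_le (x := D i)
    (abs_le.2 ⟨by linarith [h₂ i], by linarith [h₁ i]⟩)
  have := (abs_le.1 h).2
  nlinarith

theorem exp_le_trace_exp_of_not_posSemidef {A : Matrix ι ι ℝ} (hA : A.IsHermitian) {t : ℝ}
    (h : ¬ (t • 1 - A).PosSemidef) : Real.exp t ≤ (NormedSpace.exp A).trace := by
  obtain ⟨U, D, hU', hU, rfl⟩ := hA.exists_conj_diagonal
  have e1 : t • (1 : Matrix ι ι ℝ) = U * diagonal (fun _ => t) * Uᴴ := by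
    rw [← smul_one_eq_diagonal, mul_smul_comm, mul_one, smul_mul_assoc, hU]
  rw [e1, ← sub_mul, ← mul_sub, diagonal_sub, posSemidef_conj_diagonal_iff hU'] at h
  push Not at h
  obtain ⟨i, hi⟩ := h
  rw [exp_conj_diagonal hU, trace_conj_of_mul_eq_one hU', trace_diagonal]
  exact (Real.exp_le_exp.2 (by linarith)).trans
    (Finset.single_le_sum (f := fun i => Real.exp (D i)) (fun j _ => (Real.exp_pos _).le)
      (Finset.mem_univ i))

open scoped MatrixOrder in
theorem PosSemidef.exists_conjTranspose_mul_self {A : Matrix ι ι ℝ} (hA : A.PosSemidef) :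
    ∃ B : Matrix ι ι ℝ, A = Bᴴ * B :=
  CStarAlgebra.nonneg_iff_eq_star_mul_self.1 hA.nonneg

theorem PosSemidef.trace_mul_nonneg {A B : Matrix ι ι ℝ} (hA : A.PosSemidef) (hB : B.PosSemidef) :
    0 ≤ (A * B).trace := by
  obtain ⟨C, rfl⟩ := hA.exists_conjTranspose_mul_self
  rw [mul_assoc, trace_mul_comm]
  exact (hB.mul_mul_conjTranspose_same C).trace_nonneg

open scoped Matrix.Norms.L2Operator in
theorem continuous_exp : Continuous (NormedSpace.exp : Matrix ι ι ℝ → Matrix ι ι ℝ) := by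
  let _ : NormedAlgebra ℚ (Matrix ι ι ℝ) := NormedAlgebra.restrictScalars ℚ ℝ _
  exact NormedSpace.exp_continuous

theorem continuous_exp_apply (i j : ι) :
    Continuous fun A : ι → ι → ℝ => NormedSpace.exp (Matrix.of A) i j :=
  (continuous_apply_apply i j).comp (continuous_exp.comp continuous_id)

/-- By compactness of the cube of matrices with bounded entries. It makes exponentials of bounded
random matrices integrable. -/
theorem exists_bound_exp (b : ℝ) : ∃ C : ℝ, ∀ A : Matrix ι ι ℝ, (∀ i j, |A i j| ≤ b) →
    ∀ i j, |NormedSpace.exp A i j| ≤ C := by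
  have hK : IsCompact (Set.univ.pi fun _ : ι => Set.univ.pi fun _ : ι => Set.Icc (-b) b) :=
    isCompact_univ_pi fun _ => isCompact_univ_pi fun _ => isCompact_Icc
  choose C hC using fun i j => hK.exists_bound_of_continuousOn
    (continuous_exp_apply (ι := ι) i j).continuousOn
  refine ⟨∑ i, ∑ j, |C i j|, fun A hA i j => ?_⟩
  refine ((hC i j A fun k _ l _ => abs_le.1 (hA k l)).trans (le_abs_self _)).trans ?_
  exact (Finset.single_le_sum (f := fun j => |C i j|) (fun _ _ => abs_nonneg _)
    (Finset.mem_univ j)).trans (Finset.single_le_sum (f := fun i => ∑ j, |C i j|)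
      (fun _ _ => Finset.sum_nonneg fun _ _ => abs_nonneg _) (Finset.mem_univ i))

/-- Testing `A` on `e_i ± e_j` gives `2 |A i j| ≤ A i i + A j j`, and the diagonal is at most `R`.
-/
theorem PosSemidef.abs_apply_le {A : Matrix ι ι ℝ} {R : ℝ} (hA : A.PosSemidef)
    (hR : (R • 1 - A).PosSemidef) (i j : ι) : |A i j| ≤ R := by
  have hs : A j i = A i j := by simpa using hA.1.apply i j
  have hdiag : ∀ k, A k k ≤ R := fun k => by
    have := hR.diag_nonneg (i := k)
    simp at this
    linarith
  have hq : ∀ s : ℝ, 0 ≤ A i i + s * A i j + s * (A j i + s * A j j) := fun s => by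
    have h := hA.dotProduct_mulVec_nonneg (Pi.single i 1 + s • Pi.single j 1)
    simp [mulVec_add, mulVec_smul, add_dotProduct, dotProduct_add] at h
    linarith
  have h1 := hq 1
  have h2 := hq (-1)
  rw [abs_le]
  constructor <;> linarith [hdiag i, hdiag j]

end Spectral

/-! ### Entrywise expectation of random matrices. -/

section Expectation

variable {ι Θ : Type*} [MeasurableSpace Θ]

/-- The entrywise expectation of a random matrix. -/
noncomputable def expectation (μ : Measure Θ) (Z : Θ → Matrix ι ι ℝ) : Matrix ι ι ℝ :=
  Matrix.of fun i j => ∫ t, Z t i j ∂μ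

variable {μ : Measure Θ} {Z W : Θ → Matrix ι ι ℝ}

theorem expectation_apply (i j : ι) : expectation μ Z i j = ∫ t, Z t i j ∂μ := rfl

theorem expectation_sub (hZ : ∀ i j, Integrable (fun t => Z t i j) μ)
    (hW : ∀ i j, Integrable (fun t => W t i j) μ) :
    expectation μ (fun t => Z t - W t) = expectation μ Z - expectation μ W := by
  ext i j
  exact integral_sub (hZ i j) (hW i j)

theorem expectation_const [IsProbabilityMeasure μ] (A : Matrix ι ι ℝ) :
    expectation μ (fun _ => A) = A := by
  ext i j
  simp [expectation_apply]

variable [Fintype ι]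

theorem posSemidef_expectation (hZ : ∀ i j, Integrable (fun t => Z t i j) μ)
    (h : ∀ᵐ t ∂μ, (Z t).PosSemidef) : (expectation μ Z).PosSemidef := by
  refine PosSemidef.of_dotProduct_mulVec_nonneg ?_ fun x => ?_
  · ext i j
    exact integral_congr_ae (h.mono fun t ht => ht.1.apply i j)
  · have e : star x ⬝ᵥ (expectation μ Z *ᵥ x) = ∫ t, star x ⬝ᵥ (Z t *ᵥ x) ∂μ := by
      simp only [dotProduct, mulVec]
      rw [integral_finsetSum _ fun i _ =>
        (integrable_finsetSum _ fun j _ => (hZ i j).mul_const _).const_mul _]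
      refine Finset.sum_congr rfl fun i _ => ?_
      rw [integral_const_mul, integral_finsetSum _ fun j _ => (hZ i j).mul_const _]
      congr 1
      exact Finset.sum_congr rfl fun j _ => (integral_mul_const _ _).symm
    rw [e]
    exact integral_nonneg_of_ae (h.mono fun t ht => ht.dotProduct_mulVec_nonneg x)

variable [DecidableEq ι]

/-- With each entry of `L A` a finite combination of entries of `A`, measurability, integrability
and expectation pass through `L`. -/
theorem linearMap_apply_apply (L : Matrix ι ι ℝ →ₗ[ℝ] Matrix ι ι ℝ) (A : Matrix ι ι ℝ) (i j : ι) :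
    L A i j = ∑ k, ∑ l, A k l * L (single k l 1) i j := by
  conv_lhs => rw [matrix_eq_sum_single A]
  have e : ∀ k l, single k l (A k l) = A k l • single k l (1 : ℝ) := fun k l => by simp
  simp only [e, map_sum, map_smul, sum_apply, smul_apply, smul_eq_mul]

theorem integrable_linearMap_apply (L : Matrix ι ι ℝ →ₗ[ℝ] Matrix ι ι ℝ)
    (hZ : ∀ i j, Integrable (fun t => Z t i j) μ) (i j : ι) :
    Integrable (fun t => L (Z t) i j) μ := by
  rw [funext fun t => linearMap_apply_apply L (Z t) i j]
  exact integrable_finsetSum _ fun k _ => integrable_finsetSum _ fun l _ => (hZ k l).mul_const _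

theorem expectation_linearMap (L : Matrix ι ι ℝ →ₗ[ℝ] Matrix ι ι ℝ)
    (hZ : ∀ i j, Integrable (fun t => Z t i j) μ) :
    expectation μ (fun t => L (Z t)) = L (expectation μ Z) := by
  ext i j
  rw [expectation_apply, linearMap_apply_apply, funext fun t => linearMap_apply_apply L (Z t) i j]
  rw [integral_finsetSum _ fun k _ => integrable_finsetSum _ fun l _ => (hZ k l).mul_const _]
  refine Finset.sum_congr rfl fun k _ => ?_
  rw [integral_finsetSum _ fun l _ => (hZ k l).mul_const _]
  exact Finset.sum_congr rfl fun l _ => integral_mul_const _ _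

theorem measurable_exp_apply (hZ : ∀ i j, Measurable fun t => Z t i j) (i j : ι) :
    Measurable fun t => NormedSpace.exp (Z t) i j :=
  (continuous_exp_apply i j).measurable.comp
    (measurable_pi_lambda _ fun k => measurable_pi_lambda _ fun l => hZ k l)

end Expectation

end Matrix

/-! ### The matrix Laplace transform method. -/

namespace Matrix

variable {ι Θ Ω : Type*} [Fintype ι] [DecidableEq ι] [MeasurableSpace Θ] [MeasurableSpace Ω]
  {μ : Measure Θ} {P : Measure Ω} [IsProbabilityMeasure P]

/-- The **matrix Laplace transform method**, trace bound. -/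
theorem integral_trace_exp_sum_le {m : ℕ} {θ : Fin m → Ω → Θ} (hθ : ∀ s, HasLaw (θ s) μ P)
    (hind : iIndepFun θ P) {Y : Θ → Matrix ι ι ℝ} (hmeas : ∀ i j, Measurable fun t => Y t i j)
    (hsymm : ∀ t, (Y t).IsHermitian) {b : ℝ} (hb : ∀ᵐ t ∂μ, ∀ i j, |Y t i j| ≤ b)
    {a : ℝ} (ha : (a • 1 - expectation μ fun t => NormedSpace.exp (Y t)).PosSemidef) (ha0 : 0 ≤ a)
    (S : Finset (Fin m)) :
    (∀ i j, Integrable (fun ω => NormedSpace.exp (∑ s ∈ S, Y (θ s ω)) i j) P) ∧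
      ∫ ω, (NormedSpace.exp (∑ s ∈ S, Y (θ s ω))).trace ∂P ≤ Fintype.card ι * a ^ S.card := by
  have hbP : ∀ᵐ ω ∂P, ∀ s i j, |Y (θ s ω) i j| ≤ b := by
    refine ae_all_iff.2 fun s => ?_
    have h := hb
    rw [← (hθ s).map_eq] at h
    exact ae_of_ae_map (hθ s).aemeasurable h
  have hexpm : ∀ (T : Finset (Fin m)) i j,
      Measurable fun q : T → Θ => NormedSpace.exp (∑ s, Y (q s)) i j := fun T i j => by
    refine measurable_exp_apply (fun k l => ?_) i j
    simp only [sum_apply]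
    exact Finset.measurable_fun_sum _ fun s _ => (hmeas k l).comp (measurable_pi_apply s)
  have hexp_eq : ∀ (T : Finset (Fin m)) i j,
      (fun ω => NormedSpace.exp (∑ s ∈ T, Y (θ s ω)) i j) =
        (fun q : T → Θ => NormedSpace.exp (∑ s, Y (q s)) i j) ∘ fun ω s => θ s ω := by
    intro T i j
    ext ω
    simp only [Function.comp_apply]
    rw [Finset.sum_coe_sort T fun s => Y (θ s ω)]
  have hint : ∀ (T : Finset (Fin m)) i j,
      Integrable (fun ω => NormedSpace.exp (∑ s ∈ T, Y (θ s ω)) i j) P := by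
    intro T i j
    obtain ⟨C, hC⟩ := exists_bound_exp (ι := ι) (T.card * b)
    refine Integrable.of_bound (C := C) ?_ ?_
    · rw [hexp_eq]
      exact ((hexpm T i j).comp_aemeasurable
        (aemeasurable_pi_lambda _ fun s => (hθ s).aemeasurable)).aestronglyMeasurable
    · filter_upwards [hbP] with ω hω
      refine hC _ (fun k l => ?_) i j
      rw [sum_apply]
      refine (Finset.abs_sum_le_sum_abs _ _).trans ((Finset.sum_le_sum fun s _ => hω s k l).trans ?_)
      simp
  have hherm : ∀ (T : Finset (Fin m)) ω, (∑ s ∈ T, Y (θ s ω)).IsHermitian := fun T ω => by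
    rw [IsHermitian, conjTranspose_sum]
    exact Finset.sum_congr rfl fun s _ => (hsymm _).eq
  refine ⟨hint S, ?_⟩
  induction S using Finset.induction_on with
  | empty => simp
  | insert s S hs ih =>
    set E := expectation P fun ω => NormedSpace.exp (∑ s ∈ S, Y (θ s ω)) with hE
    set F := expectation μ fun t => NormedSpace.exp (Y t) with hF
    have hEpos : E.PosSemidef :=
      posSemidef_expectation (hint S) (Filter.Eventually.of_forall fun ω => posSemidef_exp (hherm S ω))
    have htr : E.trace = ∫ ω, (NormedSpace.exp (∑ s ∈ S, Y (θ s ω))).trace ∂P := by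
      simp only [trace, diag]
      rw [integral_finsetSum _ fun i _ => hint S i i]
      rfl
    have hYint : ∀ i j, Integrable (fun ω => NormedSpace.exp (Y (θ s ω)) i j) P := fun i j => by
      simpa using hint {s} i j
    have hindep : ∀ i j, IndepFun (fun ω => NormedSpace.exp (∑ s ∈ S, Y (θ s ω)) i j)
        (fun ω => NormedSpace.exp (Y (θ s ω)) j i) P := fun i j => by
      have h := (hind.indepFun_finset₀ S {s} (by simpa using hs)
        fun s => (hθ s).aemeasurable).comp (hexpm S i j) (hexpm {s} j i)
      have h2 := hexp_eq {s} j i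
      simp only [Finset.sum_singleton] at h2
      rw [hexp_eq S i j, h2]
      exact h
    have hFθ : ∀ i j, ∫ ω, NormedSpace.exp (Y (θ s ω)) i j ∂P = F i j := fun i j => by
      rw [hF, expectation_apply]
      exact (hθ s).integral_comp (f := fun t => NormedSpace.exp (Y t) i j)
        (measurable_exp_apply hmeas i j).aestronglyMeasurable
    have hmulint : ∀ i j, Integrable (fun ω => NormedSpace.exp (∑ s ∈ S, Y (θ s ω)) i j *
        NormedSpace.exp (Y (θ s ω)) j i) P := fun i j =>
      (hindep i j).integrable_mul (hint S i j) (hYint j i)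
    -- Entrywise independence factors the expected trace, with no conditional expectation needed.
    have hprod : ∫ ω, (NormedSpace.exp (∑ s ∈ S, Y (θ s ω)) *
        NormedSpace.exp (Y (θ s ω))).trace ∂P = (E * F).trace := by
      simp only [trace, diag, mul_apply]
      rw [integral_finsetSum _ fun i _ => integrable_finsetSum _ fun j _ => hmulint i j]
      refine Finset.sum_congr rfl fun i _ => ?_
      rw [integral_finsetSum _ fun j _ => hmulint i j]
      refine Finset.sum_congr rfl fun j _ => ?_
      rw [← hFθ j i, hE, expectation_apply]
      exact (hindep i j).integral_fun_mul_eq_mul_integral (hint S i j).aestronglyMeasurable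
        (hYint j i).aestronglyMeasurable
    have hle : ∫ ω, (NormedSpace.exp (∑ s ∈ insert s S, Y (θ s ω))).trace ∂P ≤ (E * F).trace := by
      rw [← hprod]
      refine integral_mono (integrable_finsetSum _ fun i _ => hint _ i i) ?_ fun ω => ?_
      · simp only [trace, diag, mul_apply]
        exact integrable_finsetSum _ fun i _ => integrable_finsetSum _ fun j _ => hmulint i j
      · simp only
        rw [Finset.sum_insert hs, add_comm]
        exact trace_exp_add_le (hherm S ω) (hsymm _)
    -- `tr (E (a - F)) ≥ 0`, so the new summand costs at most a factor `a`.
    have h0 := hEpos.trace_mul_nonneg ha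
    rw [mul_sub, trace_sub, mul_smul_comm, mul_one, trace_smul, smul_eq_mul, htr] at h0
    rw [Finset.card_insert_of_notMem hs, pow_succ]
    nlinarith

/-- Markov's inequality: an eigenvalue above `r` forces the trace of the exponential above `e^r`. -/
theorem measureReal_not_posSemidef_le {m : ℕ} {θ : Fin m → Ω → Θ} (hθ : ∀ s, HasLaw (θ s) μ P)
    (hind : iIndepFun θ P) {Y : Θ → Matrix ι ι ℝ} (hmeas : ∀ i j, Measurable fun t => Y t i j)
    (hsymm : ∀ t, (Y t).IsHermitian) {b : ℝ} (hb : ∀ᵐ t ∂μ, ∀ i j, |Y t i j| ≤ b)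
    {a : ℝ} (ha : (a • 1 - expectation μ fun t => NormedSpace.exp (Y t)).PosSemidef) (ha0 : 0 ≤ a)
    (r : ℝ) :
    P.real {ω | ¬ (r • 1 - ∑ s, Y (θ s ω)).PosSemidef} ≤ Fintype.card ι * a ^ m * Real.exp (-r) := by
  obtain ⟨hint, hle⟩ := integral_trace_exp_sum_le hθ hind hmeas hsymm hb ha ha0 Finset.univ
  have hherm : ∀ ω, (∑ s, Y (θ s ω)).IsHermitian := fun ω => by
    rw [IsHermitian, conjTranspose_sum]
    exact Finset.sum_congr rfl fun s _ => (hsymm _).eq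
  have h1 := mul_meas_ge_le_integral_of_nonneg (μ := P)
    (f := fun ω => (NormedSpace.exp (∑ s, Y (θ s ω))).trace)
    (Filter.Eventually.of_forall fun ω => (posSemidef_exp (hherm ω)).trace_nonneg)
    (integrable_finsetSum _ fun i _ => hint i i) (Real.exp r)
  have h2 : P.real {ω | ¬ (r • 1 - ∑ s, Y (θ s ω)).PosSemidef} ≤
      P.real {ω | Real.exp r ≤ (NormedSpace.exp (∑ s, Y (θ s ω))).trace} :=
    measureReal_mono fun ω hω => exp_le_trace_exp_of_not_posSemidef (hherm ω) hω
  rw [Finset.card_univ, Fintype.card_fin] at hle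
  rw [Real.exp_neg, ← div_eq_mul_inv, le_div_iff₀ (Real.exp_pos r), mul_comm]
  exact (mul_le_mul_of_nonneg_left h2 (Real.exp_pos r).le).trans (h1.trans hle)

end Matrix

/-! ### Matrix Bernstein for bounded positive semidefinite summands. -/

namespace Matrix

section Deterministic

variable {ι : Type*} {X M : Matrix ι ι ℝ} {R κ : ℝ}

theorem posSemidef_smul_iff {A : Matrix ι ι ℝ} {r : ℝ} (hr : 0 < r) :
    (r • A).PosSemidef ↔ A.PosSemidef := by
  refine ⟨fun h => ?_, fun h => h.smul hr.le⟩
  have h1 := h.smul (inv_nonneg.2 hr.le)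
  rwa [smul_smul, inv_mul_cancel₀ hr.ne', one_smul] at h1

variable [DecidableEq ι]

theorem posSemidef_one_sub_smul_sub (hX : X.PosSemidef) (hRX : (R • 1 - X).PosSemidef)
    (hM : M.PosSemidef) (hRM : (R • 1 - M).PosSemidef) (hκ : |κ| * R ≤ 1) :
    (1 - κ • (X - M)).PosSemidef := by
  rcases le_total 0 κ with h | h
  · rw [abs_of_nonneg h] at hκ
    have e : 1 - κ • (X - M) =
        (1 - κ * R) • (1 : Matrix ι ι ℝ) + κ • (R • 1 - X) + κ • M := by module
    rw [e]
    exact ((PosSemidef.one.smul (by linarith)).add (hRX.smul h)).add (hM.smul h)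
  · rw [abs_of_nonpos h] at hκ
    have e : 1 - κ • (X - M) =
        (1 - -κ * R) • (1 : Matrix ι ι ℝ) + (-κ) • X + (-κ) • (R • 1 - M) := by module
    rw [e]
    exact ((PosSemidef.one.smul (by linarith)).add (hX.smul (by linarith))).add
      (hRM.smul (by linarith))

variable [Fintype ι]

/-- `R (R X - X²) = X (R - X) X + (R - X) X (R - X)`, a sum of congruences of positive semidefinite
matrices. -/
theorem PosSemidef.smul_sub_mul_self (hX : X.PosSemidef) (hR : (R • 1 - X).PosSemidef)
    (hR0 : 0 < R) : (R • X - X * X).PosSemidef := by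
  rw [← posSemidef_smul_iff hR0]
  have h1 := hR.conjTranspose_mul_mul_same X
  have h2 := hX.conjTranspose_mul_mul_same (R • 1 - X)
  rw [hX.1.eq] at h1
  rw [hR.1.eq] at h2
  have e : R • (R • X - X * X) =
      X * (R • 1 - X) * X + (R • 1 - X) * X * (R • 1 - X) := by
    simp only [mul_sub, sub_mul, smul_mul_assoc, mul_smul_comm, mul_one, one_mul, mul_assoc]
    module
  rw [e]
  exact h1.add h2

/-- Pointwise form of the moment bound: the subtracted last term is linear in `X - M`, so it
vanishes in expectation. The slack is the sum of `1 + Y + Y² - e^Y` for `Y = κ (X - M)` and `κ²`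
times `R X - X²`, `R (1 - M)` and `M²`. -/
theorem posSemidef_smul_one_sub_exp (hX : X.PosSemidef) (hRX : (R • 1 - X).PosSemidef)
    (hM : M.PosSemidef) (hRM : (R • 1 - M).PosSemidef) (hM1 : (1 - M).PosSemidef) (hR : 0 < R)
    (hκ : |κ| * R ≤ 1) :
    ((1 + κ ^ 2 * R) • 1 - NormedSpace.exp (κ • (X - M)) -
      (-κ • (X - M) + κ ^ 2 • (-R • (X - M) + (X - M) * M + M * (X - M)))).PosSemidef := by
  have h1 := posSemidef_one_sub_smul_sub hX hRX hM hRM hκ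
  have h2 := posSemidef_one_sub_smul_sub hX hRX hM hRM (κ := -κ) (by rwa [abs_neg])
  rw [neg_smul, sub_neg_eq_add] at h2
  have h3 := posSemidef_one_add_add_sq_sub_exp h1 h2
  have h4 : (M * M).PosSemidef := by
    have := posSemidef_conjTranspose_mul_self M
    rwa [hM.1.eq] at this
  have h5 := h3.add (((hX.smul_sub_mul_self hRX hR).add
    ((hM1.smul hR.le).add h4)).smul (sq_nonneg κ))
  convert h5 using 1
  generalize NormedSpace.exp (κ • (X - M)) = E
  simp only [mul_sub, sub_mul, smul_mul_assoc, mul_smul_comm]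
  module

end Deterministic

variable {ι Θ Ω : Type*} [Fintype ι] [DecidableEq ι] [MeasurableSpace Θ] [MeasurableSpace Ω]
  {μ : Measure Θ} [IsProbabilityMeasure μ] {X : Θ → Matrix ι ι ℝ} {R : ℝ}

theorem posSemidef_smul_one_sub_expectation_exp (hmeas : ∀ i j, Measurable fun t => X t i j)
    (hX : ∀ᵐ t ∂μ, (X t).PosSemidef ∧ (R • 1 - X t).PosSemidef)
    (hM : (1 - expectation μ X).PosSemidef) (hR : 0 < R) {κ : ℝ} (hκ : |κ| * R ≤ 1) :
    ((1 + κ ^ 2 * R) • 1 -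
      expectation μ fun t => NormedSpace.exp (κ • (X t - expectation μ X))).PosSemidef ∧
    ∃ b, ∀ᵐ t ∂μ, ∀ i j, |(κ • (X t - expectation μ X)) i j| ≤ b := by
  set M := expectation μ X with hMdef
  have hXint : ∀ i j, Integrable (fun t => X t i j) μ := fun i j =>
    Integrable.of_bound (C := R) (hmeas i j).aestronglyMeasurable
      (hX.mono fun t ht => ht.1.abs_apply_le ht.2 i j)
  have hci : ∀ (A : Matrix ι ι ℝ) i j, Integrable (fun _ : Θ => A i j) μ :=
    fun A i j => integrable_const _
  have hM0 : M.PosSemidef := posSemidef_expectation hXint (hX.mono fun t ht => ht.1)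
  have hRM : (R • 1 - M).PosSemidef := by
    have h := posSemidef_expectation (Z := fun t => R • 1 - X t)
      (fun i j => (hci (R • 1) i j).sub (hXint i j)) (hX.mono fun t ht => ht.2)
    rwa [expectation_sub (hci _) hXint, expectation_const] at h
  have hb : ∀ᵐ t ∂μ, ∀ i j, |(κ • (X t - M)) i j| ≤ |κ| * (R + R) := by
    filter_upwards [hX] with t ht i j
    rw [smul_apply, sub_apply, smul_eq_mul, abs_mul]
    exact mul_le_mul_of_nonneg_left ((abs_sub _ _).trans
      (add_le_add (ht.1.abs_apply_le ht.2 i j) (hM0.abs_apply_le hRM i j))) (abs_nonneg _)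
  refine ⟨?_, _, hb⟩
  have hexp : ∀ i j, Integrable (fun t => NormedSpace.exp (κ • (X t - M)) i j) μ := fun i j => by
    obtain ⟨C, hC⟩ := exists_bound_exp (ι := ι) (|κ| * (R + R))
    refine Integrable.of_bound (C := C) (measurable_exp_apply (fun k l => ?_) i j
      ).aestronglyMeasurable (hb.mono fun t ht => hC _ ht i j)
    exact ((hmeas k l).sub_const _).const_mul κ
  let L : Matrix ι ι ℝ →ₗ[ℝ] Matrix ι ι ℝ := -κ • LinearMap.id +
    κ ^ 2 • (-R • LinearMap.id + LinearMap.mulRight ℝ M + LinearMap.mulLeft ℝ M)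
  have hXM : ∀ i j, Integrable (fun t => (X t - M) i j) μ := fun i j => (hXint i j).sub (hci M i j)
  have hLint := integrable_linearMap_apply L hXM
  have hL : expectation μ (fun t => L (X t - M)) = 0 := by
    rw [expectation_linearMap L hXM, expectation_sub hXint (hci M), expectation_const, ← hMdef,
      sub_self, map_zero]
  have hd : ∀ i j, Integrable (fun t => ((1 + κ ^ 2 * R) • (1 : Matrix ι ι ℝ) -
      NormedSpace.exp (κ • (X t - M))) i j) μ := fun i j => (hci _ i j).sub (hexp i j)
  have h := posSemidef_expectation (μ := μ) (Z := fun t => (1 + κ ^ 2 * R) • (1 : Matrix ι ι ℝ) -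
      NormedSpace.exp (κ • (X t - M)) - L (X t - M)) (fun i j => (hd i j).sub (hLint i j))
    (hX.mono fun t ht => posSemidef_smul_one_sub_exp ht.1 ht.2 hM0 hRM hM hR hκ)
  rwa [expectation_sub hd hLint, hL, sub_zero, expectation_sub (hci _) hexp,
    expectation_const] at h

variable {P : Measure Ω} [IsProbabilityMeasure P] {m : ℕ} {θ : Fin m → Ω → Θ}

/-- The sign `σ = ±1` treats both tails at once. -/
theorem measureReal_one_sided_deviation_le (hθ : ∀ s, HasLaw (θ s) μ P)
    (hind : iIndepFun θ P) (hm : 0 < m) (hmeas : ∀ i j, Measurable fun t => X t i j)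
    (hsymm : ∀ t, (X t).IsHermitian) (hX : ∀ᵐ t ∂μ, (X t).PosSemidef ∧ (R • 1 - X t).PosSemidef)
    (hM : (1 - expectation μ X).PosSemidef) (hR : 0 < R) {ε : ℝ} (hε : 0 < ε) {σ : ℝ}
    (hσ : σ ^ 2 = 1) :
    P.real {ω | ¬ (ε • 1 - σ • ((1 / (m : ℝ)) • ∑ s, X (θ s ω) - expectation μ X)).PosSemidef} ≤
      Fintype.card ι * Real.exp (-(m * ε ^ 2 / (4 * R * (1 + ε)))) := by
  have hm0 : (0 : ℝ) < m := by exact_mod_cast hm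
  set M := expectation μ X with hMdef
  -- This `τ` has `τ R ≤ 1`, as the exponential bound needs, and `τ R ≤ ε / 2`, so the exponent `m τ
  -- (τ R - ε)` is at most `-m τ ε / 2`.
  set τ := ε / (2 * R * (1 + ε)) with hτ
  have hτ0 : 0 < τ := by positivity
  have hτR : τ * R = ε / (2 * (1 + ε)) := by rw [hτ]; field_simp
  have habs : |σ * τ| * R ≤ 1 := by
    have h1 : |σ| = 1 := by rw [← sq_eq_sq₀ (abs_nonneg _) zero_le_one, sq_abs, hσ, one_pow]
    rw [abs_mul, h1, one_mul, abs_of_pos hτ0, hτR, div_le_one (by positivity)]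
    linarith
  obtain ⟨ha, b, hb⟩ := posSemidef_smul_one_sub_expectation_exp hmeas hX hM hR habs
  have hM' : M.IsHermitian := by
    have h := isHermitian_one.sub hM.1
    rwa [sub_sub_cancel] at h
  have h := measureReal_not_posSemidef_le hθ hind
    (Y := fun t => (σ * τ) • (X t - M)) (fun i j => ((hmeas i j).sub_const _).const_mul _)
    (fun t => by
      rw [IsHermitian, conjTranspose_smul, ((hsymm t).sub hM').eq, star_trivial])
    hb ha (by positivity) (τ * m * ε)
  have hset : ∀ ω, (τ * m * ε) • (1 : Matrix ι ι ℝ) - ∑ s, (σ * τ) • (X (θ s ω) - M) =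
      (τ * m) • (ε • 1 - σ • ((1 / (m : ℝ)) • ∑ s, X (θ s ω) - M)) := fun ω => by
    rw [← Finset.smul_sum, Finset.sum_sub_distrib, Finset.sum_const, Finset.card_univ,
      Fintype.card_fin, ← Nat.cast_smul_eq_nsmul ℝ]
    match_scalars <;> field_simp
  simp only [hset, posSemidef_smul_iff (mul_pos hτ0 hm0)] at h
  refine h.trans ?_
  rw [mul_assoc]
  refine mul_le_mul_of_nonneg_left ?_ (Nat.cast_nonneg _)
  have h2 : 1 + (σ * τ) ^ 2 * R ≤ Real.exp (τ ^ 2 * R) := by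
    rw [mul_pow, hσ, one_mul, add_comm]
    exact Real.add_one_le_exp _
  calc (1 + (σ * τ) ^ 2 * R) ^ m * Real.exp (-(τ * m * ε))
      ≤ Real.exp (τ ^ 2 * R) ^ m * Real.exp (-(τ * m * ε)) :=
        mul_le_mul_of_nonneg_right (pow_le_pow_left₀ (by positivity) h2 m) (Real.exp_pos _).le
    _ = Real.exp (m * (τ ^ 2 * R) - τ * m * ε) := by
        rw [← Real.exp_nat_mul, ← Real.exp_add, sub_eq_add_neg]
    _ ≤ Real.exp (-(m * ε ^ 2 / (4 * R * (1 + ε)))) := by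
        refine Real.exp_le_exp.2 ?_
        have h3 : m * ε ^ 2 / (4 * R * (1 + ε)) = m * τ * (ε / 2) := by
          rw [hτ]; field_simp; ring
        have h4 : τ * R ≤ ε / 2 := by
          rw [hτR]; exact div_le_div_of_nonneg_left hε.le two_pos (by linarith)
        rw [h3]
        have h5 := mul_le_mul_of_nonneg_left h4 (mul_pos hm0 hτ0).le
        nlinarith

/-- A **matrix Bernstein inequality** for averages of i.i.d. positive semidefinite matrices. -/
theorem measureReal_deviation_le (hθ : ∀ s, HasLaw (θ s) μ P)
    (hind : iIndepFun θ P) (hm : 0 < m) (hmeas : ∀ i j, Measurable fun t => X t i j)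
    (hsymm : ∀ t, (X t).IsHermitian) (hX : ∀ᵐ t ∂μ, (X t).PosSemidef ∧ (R • 1 - X t).PosSemidef)
    (hM : (1 - expectation μ X).PosSemidef) (hR : 0 < R) {ε : ℝ} (hε : 0 < ε) :
    P.real {ω | ¬ ((ε • 1 - ((1 / (m : ℝ)) • ∑ s, X (θ s ω) - expectation μ X)).PosSemidef ∧
      (ε • 1 + ((1 / (m : ℝ)) • ∑ s, X (θ s ω) - expectation μ X)).PosSemidef)} ≤
      2 * (Fintype.card ι * Real.exp (-(m * ε ^ 2 / (4 * R * (1 + ε))))) := by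
  have h1 := measureReal_one_sided_deviation_le hθ hind hm hmeas hsymm hX hM hR hε
    (σ := 1) (by norm_num)
  have h2 := measureReal_one_sided_deviation_le hθ hind hm hmeas hsymm hX hM hR hε
    (σ := -1) (by norm_num)
  simp only [one_smul] at h1
  simp only [neg_smul, one_smul, sub_neg_eq_add] at h2
  rw [two_mul]
  refine le_trans ?_ (add_le_add h1 h2)
  refine (measureReal_mono fun ω hω => ?_).trans (measureReal_union_le _ _)
  simp only [Set.mem_ofPred_eq, not_and_or] at hω
  exact hω

end Matrix

/-! ### Bucket matrices. -/

section Bucket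

namespace Matrix

variable {ι κ : Type*} [Fintype ι] [DecidableEq κ]

/-- The matrix is the sum over buckets `b` of `v_b v_bᵀ`, with `v_b` the restriction of `v` to `b`.
-/
theorem posSemidef_bucket (h : ι → κ) (v : ι → ℝ) :
    (Matrix.of fun i j => if h i = h j then v i * v j else 0).PosSemidef := by
  have e : (Matrix.of fun i j => if h i = h j then v i * v j else 0) =
      ∑ b ∈ Finset.univ.image h, vecMulVec (fun i => if h i = b then v i else 0)
        (star fun i => if h i = b then v i else 0) := by
    ext i j
    simp only [of_apply, sum_apply, vecMulVec_apply, star_trivial, ite_mul, zero_mul]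
    rw [Finset.sum_ite_eq, if_pos (Finset.mem_image_of_mem h (Finset.mem_univ i))]
    simp only [mul_ite, mul_zero, eq_comm]
  rw [e]
  exact posSemidef_sum _ fun b _ => posSemidef_vecMulVec_self_star _

/-- Entries are at most `F ^ 2` in absolute value; bound each `|x i x j|` by `(x i ^ 2 + x j ^ 2) /
2` and sum. -/
theorem posSemidef_smul_one_sub_bucket [DecidableEq ι] (h : ι → κ) {v : ι → ℝ} {F : ℝ} (hv : ∀ i, |v i| ≤ F) :
    ((Fintype.card ι * F ^ 2) • 1 -
      Matrix.of fun i j => if h i = h j then v i * v j else 0).PosSemidef := by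
  refine PosSemidef.of_dotProduct_mulVec_nonneg
    ((isHermitian_one.smul (IsSelfAdjoint.all _)).sub (posSemidef_bucket h v).1) fun x => ?_
  have hle : ∀ i j, x i * ((if h i = h j then v i * v j else 0) * x j) ≤
      F ^ 2 / 2 * x i ^ 2 + F ^ 2 / 2 * x j ^ 2 := fun i j => by
    have hvv : |if h i = h j then v i * v j else 0| ≤ F ^ 2 := by
      split_ifs
      · rw [abs_mul, pow_two]
        exact mul_le_mul (hv i) (hv j) (abs_nonneg _) ((abs_nonneg _).trans (hv i))
      · rw [abs_zero]; positivity
    generalize (if h i = h j then v i * v j else 0) = q at hvv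
    have := abs_le.1 hvv
    nlinarith [sq_nonneg (x i + x j), sq_nonneg (x i - x j)]
  have hsum := Finset.sum_le_sum fun i (_ : i ∈ Finset.univ) =>
    Finset.sum_le_sum fun j (_ : j ∈ Finset.univ) => hle i j
  simp only [Finset.sum_add_distrib, Finset.sum_const, Finset.card_univ, nsmul_eq_mul,
    ← Finset.mul_sum] at hsum
  have hx : x ⬝ᵥ x = ∑ i, x i ^ 2 := Finset.sum_congr rfl fun i _ => (pow_two _).symm
  rw [star_trivial, sub_mulVec, smul_mulVec, one_mulVec, dotProduct_sub, dotProduct_smul, hx,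
    smul_eq_mul, sub_nonneg]
  exact hsum.trans_eq (by ring)

end Matrix

end Bucket

namespace WLSH

/-! ### The mean of the estimator in dimension one. -/

section OneDimensional

variable {f : ℝ → ℝ}

/-- The value of `f` at the displacement of `a` from the centre of its bucket. -/
noncomputable def cell (f : ℝ → ℝ) (w z a : ℝ) : ℝ := f (round ((a - z) / w) + (z - a) / w)

/-- The WLSH estimator in dimension one. -/
noncomputable def estimatorOne (f : ℝ → ℝ) (w z a b : ℝ) : ℝ :=
  if round ((a - z) / w) = round ((b - z) / w) then cell f w z a * cell f w z b else 0

theorem IsBucketShape.eq_zero (hf : IsBucketShape f) {t : ℝ} (ht : t ∉ Set.Icc (-1 / 2) (1 / 2)) :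
    f t = 0 := by
  by_contra h
  exact ht (hf.support_subset h)

theorem integral_mul_eq_convolution (hf : IsBucketShape f) (a b : ℝ) :
    ∫ t, f (t - a) * f (t - b) = convolution f f (ContinuousLinearMap.mul ℝ ℝ) volume (a - b) := by
  rw [convolution_def]
  have h1 : (fun t => f (t - a) * f (t - b)) = fun t => f (t - a) * f (t - a + (a - b)) := by
    ext t; congr 2; ring
  rw [h1, integral_sub_right_eq_self (fun t => f t * f (t + (a - b))) a,
    ← integral_neg_eq_self]
  refine integral_congr_ae (Filter.Eventually.of_forall fun t => ?_)
  simp only [ContinuousLinearMap.mul_apply']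
  rw [hf.even t]
  congr 2; ring

/-- Periodicity in the shift moves the integral to the unit window centred at `a`, where `a` hashes
to `0`. There the integrand is `f (t - a) * f (t - b)`: if `b` hashes elsewhere, `t - b` is a.e.
outside the support of `f`. -/
theorem intervalIntegral_estimatorOne_one (hf : IsBucketShape f) (a b : ℝ) :
    ∫ t in (0 : ℝ)..1, estimatorOne f 1 t a b =
      convolution f f (ContinuousLinearMap.mul ℝ ℝ) volume (a - b) := by
  have hper : Function.Periodic (fun t => estimatorOne f 1 t a b) 1 := fun t => by
    have hr : ∀ c : ℝ, round (c - (t + 1)) = round (c - t) - 1 := fun c => by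
      rw [← sub_sub, round_sub_one]
    have hc : ∀ c : ℝ, cell f 1 (t + 1) c = cell f 1 t c := fun c => by
      simp only [cell, div_one, hr]
      push_cast
      congr 1; ring
    simp only [estimatorOne, div_one, hr, hc, sub_left_inj]
  have h1 := hper.intervalIntegral_add_eq 0 (a - 1 / 2)
  rw [zero_add] at h1
  rw [h1, intervalIntegral.integral_of_le (by linarith), integral_Ioc_eq_integral_Ioo,
    ← integral_mul_eq_convolution hf,
    ← setIntegral_eq_integral_of_forall_compl_eq_zero (f := fun t => f (t - a) * f (t - b))
      (s := Set.Icc (a - 1 / 2) (a - 1 / 2 + 1)),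
    integral_Icc_eq_integral_Ioo]
  · refine setIntegral_congr_ae measurableSet_Ioo ?_
    filter_upwards [compl_mem_ae_iff.2 (measure_singleton (b - 1 / 2)),
      compl_mem_ae_iff.2 (measure_singleton (b + 1 / 2))] with t ht1 ht2 ht
    have ha : round (a - t) = 0 := round_eq_zero_iff.2
      ⟨by linarith [ht.2], by linarith [ht.1]⟩
    simp only [estimatorOne, cell, div_one, ha]
    by_cases hb : round (b - t) = 0
    · simp [hb]
    · rw [if_neg fun h => hb h.symm, hf.eq_zero (t := t - b), mul_zero]
      intro h
      refine hb (round_eq_zero_iff.2 ⟨by linarith [h.2], ?_⟩)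
      -- Half-integers round up, so the endpoint `t = b - 1/2` is exceptional and was discarded as
      -- null.
      rcases h.1.lt_or_eq with h' | h'
      · linarith
      · exact absurd (show t = b - 1 / 2 by linarith) ht1
  · intro t ht
    rw [hf.eq_zero, zero_mul]
    exact fun h => ht ⟨by linarith [h.1], by linarith [h.2]⟩

theorem setIntegral_estimatorOne (hf : IsBucketShape f) {w : ℝ} (hw : 0 < w) (a b : ℝ) :
    ∫ z in Set.Icc 0 w, estimatorOne f w z a b =
      w * convolution f f (ContinuousLinearMap.mul ℝ ℝ) volume ((a - b) / w) := by
  have h1 : ∀ z, estimatorOne f w z a b = estimatorOne f 1 (z / w) (a / w) (b / w) := fun z => by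
    simp only [estimatorOne, cell, div_one, sub_div]
  rw [integral_Icc_eq_integral_Ioc, ← intervalIntegral.integral_of_le hw.le]
  simp only [h1]
  rw [intervalIntegral.integral_comp_div (fun t => estimatorOne f 1 t (a / w) (b / w)) hw.ne',
    zero_div, div_self hw.ne', intervalIntegral_estimatorOne_one hf, smul_eq_mul, sub_div]

end OneDimensional

/-! ### Tensorization and the almost sure bound on weights. -/

section Product

variable {d : ℕ} {f p : ℝ → ℝ}

theorem estimator_eq_prod (θ : (Fin d → ℝ) × (Fin d → ℝ)) (x y : Fin d → ℝ) :
    estimator f θ x y = ∏ l, estimatorOne f (θ.1 l) (θ.2 l) (x l) (y l) := by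
  simp only [estimator, estimatorOne, Finset.prod_ite_zero, Finset.mem_univ, true_imp_iff,
    funext_iff, Finset.prod_mul_distrib]
  rfl

theorem integral_uniformBox_estimator (hf : IsBucketShape f) {w : Fin d → ℝ} (hw : ∀ l, 0 < w l)
    (x y : Fin d → ℝ) :
    ∫ z, estimator f (w, z) x y ∂uniformBox d w =
      ∏ l, convolution f f (ContinuousLinearMap.mul ℝ ℝ) volume ((x l - y l) / w l) := by
  change ∫ z, estimator f (w, z) x y ∂ProbabilityTheory.cond volume (Set.Icc 0 w) = _
  have hvol : (volume (Set.Icc 0 w))⁻¹.toReal = ∏ l, (w l)⁻¹ := by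
    rw [Real.volume_Icc_pi, ENNReal.toReal_inv, ENNReal.toReal_prod, ← Finset.prod_inv_distrib]
    exact Finset.prod_congr rfl fun l _ => by simp [ENNReal.toReal_ofReal (hw l).le]
  rw [ProbabilityTheory.cond, integral_smul_measure, hvol, ← Set.pi_univ_Icc, volume_pi,
    Measure.restrict_pi_pi]
  simp only [estimator_eq_prod]
  rw [integral_fintype_prod_eq_prod (fun l z => estimatorOne f (w l) z (x l) (y l)), smul_eq_mul,
    ← Finset.prod_mul_distrib]
  refine Finset.prod_congr rfl fun l _ => ?_
  rw [Pi.zero_apply, setIntegral_estimatorOne hf (hw l), inv_mul_cancel_left₀ (hw l).ne']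

theorem isProbabilityMeasure_withDensity (hp : IsNonnegPDF p) :
    IsProbabilityMeasure (volume.withDensity fun t => ENNReal.ofReal (p t)) :=
  ⟨by rw [withDensity_apply _ MeasurableSet.univ, Measure.restrict_univ, hp.lintegral_eq_one]⟩

theorem isProbabilityMeasure_widthLaw (hp : IsNonnegPDF p) :
    IsProbabilityMeasure (widthLaw p d) := by
  have := isProbabilityMeasure_withDensity hp
  unfold widthLaw
  infer_instance

theorem ae_withDensity_pos (hp : IsNonnegPDF p) :
    ∀ᵐ t ∂(volume.withDensity fun t => ENNReal.ofReal (p t)), 0 < t := by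
  rw [ae_withDensity_iff hp.measurable.ennreal_ofReal]
  filter_upwards [compl_mem_ae_iff.2 (measure_singleton (0 : ℝ))] with t ht h
  have h1 : p t ≠ 0 := fun h0 => h (by rw [h0, ENNReal.ofReal_zero])
  exact lt_of_le_of_ne (hp.support_subset h1) fun h0 => ht h0.symm

theorem ae_widthLaw_pos (hp : IsNonnegPDF p) : ∀ᵐ w ∂widthLaw p d, ∀ l, 0 < w l := by
  have := isProbabilityMeasure_withDensity hp
  exact ae_all_iff.2 fun l =>
    (Measure.tendsto_eval_ae_ae (μ := fun _ : Fin d => volume.withDensity fun t =>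
      ENNReal.ofReal (p t)) (i := l)).eventually (ae_withDensity_pos hp)

theorem integral_widthLaw_prod (hp : IsNonnegPDF p) (g : Fin d → ℝ → ℝ) :
    ∫ w, ∏ l, g l (w l) ∂widthLaw p d = ∏ l, ∫ t in Set.Ioi (0 : ℝ), p t * g l t := by
  have := isProbabilityMeasure_withDensity hp
  rw [widthLaw, integral_fintype_prod_eq_prod]
  refine Finset.prod_congr rfl fun l _ => ?_
  rw [integral_withDensity_eq_integral_toReal_smul hp.measurable.ennreal_ofReal
    (Filter.Eventually.of_forall fun _ => ENNReal.ofReal_lt_top), ← integral_Ici_eq_integral_Ioi,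
    setIntegral_eq_integral_of_forall_compl_eq_zero]
  · simp only [ENNReal.toReal_ofReal (hp.nonneg _), smul_eq_mul]
  · intro t ht
    have : p t = 0 := by
      by_contra h
      exact ht (hp.support_subset h)
    rw [this, zero_mul]

theorem measurable_round : Measurable (round : ℝ → ℤ) := by
  have : (round : ℝ → ℤ) = fun x => ⌊x + 1 / 2⌋ := funext round_eq
  rw [this]
  exact Int.measurable_floor.comp (measurable_id.add_const _)

theorem measurable_hash_apply (x : Fin d → ℝ) (l : Fin d) :
    Measurable fun θ : (Fin d → ℝ) × (Fin d → ℝ) => hash θ.1 θ.2 x l := by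
  unfold hash
  exact measurable_round.comp (by fun_prop)

/-- The value of `f^{⊗ d}` at the displacement of `x` from the centre of its bucket. -/
noncomputable def weight (f : ℝ → ℝ) (x : Fin d → ℝ) (θ : (Fin d → ℝ) × (Fin d → ℝ)) : ℝ :=
  tensorPower f d fun l => (hash θ.1 θ.2 x l : ℝ) + (θ.2 l - x l) / θ.1 l

theorem measurable_tensorPower (hf : IsBucketShape f) : Measurable (tensorPower f d) :=
  Finset.measurable_fun_prod _ fun l _ => hf.measurable.comp (measurable_pi_apply l)

theorem measurable_weight (hf : IsBucketShape f) (x : Fin d → ℝ) : Measurable (weight f x) := by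
  refine (measurable_tensorPower hf).comp (measurable_pi_lambda _ fun l => Measurable.add ?_ ?_)
  · exact (measurable_of_countable _).comp (measurable_hash_apply x l)
  · fun_prop

theorem measurable_estimator (hf : IsBucketShape f) (x y : Fin d → ℝ) :
    Measurable fun θ => estimator f θ x y := by
  refine Measurable.ite ?_ ((measurable_weight hf x).mul (measurable_weight hf y)) measurable_const
  exact measurableSet_eq_fun (measurable_pi_lambda _ (measurable_hash_apply x))
    (measurable_pi_lambda _ (measurable_hash_apply y))

/-- An invertible affine map pulls null sets back to null sets. This transfers the essential bound
on `f^{⊗d}` to the random shift. -/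
theorem ae_comp_add_sub_div {w : Fin d → ℝ} (hw : ∀ l, 0 < w l) (k x : Fin d → ℝ)
    {q : (Fin d → ℝ) → Prop} (hq : ∀ᵐ u, q u) :
    ∀ᵐ z : Fin d → ℝ, q fun l => k l + (z l - x l) / w l := by
  have h1 := (measurePreserving_add_right volume
    (fun l => k l - x l / w l)).quasiMeasurePreserving.ae hq
  have hdet : LinearMap.det (Matrix.toLin' (Matrix.diagonal fun l => (w l)⁻¹)) ≠ 0 := by
    rw [LinearMap.det_toLin', Matrix.det_diagonal]
    exact Finset.prod_ne_zero_iff.2 fun l _ => (inv_pos.2 (hw l)).ne'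
  have h2 := Measure.addHaar_preimage_linearMap volume hdet
    {u | ¬ q (u + fun l => k l - x l / w l)}
  rw [ae_iff.1 h1, mul_zero] at h2
  rw [ae_iff]
  refine (congrArg volume (Set.ext fun z => ?_)).trans h2
  simp only [Set.mem_preimage, Set.mem_ofPred_eq, Matrix.toLin'_apply]
  refine not_congr (iff_of_eq (congrArg q (funext fun l => ?_)))
  simp only [Pi.add_apply, Matrix.mulVec_diagonal]
  ring

theorem ae_enorm_weight_le (hp : IsNonnegPDF p) (hf : IsBucketShape f) (x : Fin d → ℝ) :
    ∀ᵐ θ ∂lshLaw p d, ‖weight f x θ‖ₑ ≤ eLpNorm (tensorPower f d) ∞ volume := by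
  have := isProbabilityMeasure_widthLaw (d := d) hp
  have hbound : ∀ᵐ u, ‖tensorPower f d u‖ₑ ≤ eLpNorm (tensorPower f d) ∞ volume := by
    rw [eLpNorm_exponent_top]
    exact ae_le_eLpNormEssSup
  rw [lshLaw, Measure.ae_compProd_iff
    (measurableSet_le (measurable_weight hf x).enorm measurable_const)]
  filter_upwards [ae_widthLaw_pos hp] with w hw
  have h : ∀ᵐ z : Fin d → ℝ, ‖weight f x (w, z)‖ₑ ≤ eLpNorm (tensorPower f d) ∞ volume := by
    -- The hash depends on `z`, so the bound is taken for all of the countably many integer vectors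
    -- at once.
    have h1 := ae_all_iff.2 fun k : Fin d → ℤ =>
      ae_comp_add_sub_div hw (fun l => (k l : ℝ)) x hbound
    exact h1.mono fun z hz => hz (hash w z x)
  exact ProbabilityTheory.cond_absolutelyContinuous.ae_le h

end Product

end WLSH

/-! ### The estimator matrix: bounds and mean. -/

namespace WLSH

section KernelMatrix

variable {d n : ℕ} {f p : ℝ → ℝ}

theorem estimatorMatrix_eq (x : Fin n → Fin d → ℝ) (θ : (Fin d → ℝ) × (Fin d → ℝ)) :
    estimatorMatrix f x θ = Matrix.of fun i j =>
      if hash θ.1 θ.2 (x i) = hash θ.1 θ.2 (x j) then weight f (x i) θ * weight f (x j) θ else 0 :=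
  rfl

theorem posSemidef_estimatorMatrix (x : Fin n → Fin d → ℝ) (θ : (Fin d → ℝ) × (Fin d → ℝ)) :
    (estimatorMatrix f x θ).PosSemidef := by
  rw [estimatorMatrix_eq]
  exact Matrix.posSemidef_bucket (fun i => hash θ.1 θ.2 (x i)) fun i => weight f (x i) θ

theorem ae_abs_weight_le (hp : IsNonnegPDF p) (hf : IsBucketShape f)
    (hF : eLpNorm (tensorPower f d) ∞ volume ≠ ∞) (x : Fin d → ℝ) :
    ∀ᵐ θ ∂lshLaw p d, |weight f x θ| ≤ (eLpNorm (tensorPower f d) ∞ volume).toReal := by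
  filter_upwards [ae_enorm_weight_le hp hf x] with θ hθ
  have h := ENNReal.toReal_mono hF hθ
  rwa [toReal_enorm, Real.norm_eq_abs] at h

theorem ae_posSemidef_sub_estimatorMatrix (hp : IsNonnegPDF p) (hf : IsBucketShape f)
    (hF : eLpNorm (tensorPower f d) ∞ volume ≠ ∞) (x : Fin n → Fin d → ℝ) :
    ∀ᵐ θ ∂lshLaw p d, ((n * (eLpNorm (tensorPower f d) ∞ volume).toReal ^ 2) • 1 -
      estimatorMatrix f x θ).PosSemidef := by
  filter_upwards [ae_all_iff.2 fun i => ae_abs_weight_le hp hf hF (x i)] with θ hθ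
  have h := Matrix.posSemidef_smul_one_sub_bucket (fun i => hash θ.1 θ.2 (x i)) hθ
  rwa [Fintype.card_fin] at h

theorem integral_estimator (hp : IsNonnegPDF p) (hf : IsBucketShape f) {x y : Fin d → ℝ}
    (hint : Integrable (fun θ => estimator f θ x y) (lshLaw p d)) :
    ∫ θ, estimator f θ x y ∂lshLaw p d = kernel f p (x - y) := by
  have := isProbabilityMeasure_widthLaw (d := d) hp
  rw [lshLaw, Measure.integral_compProd hint, kernel,
    ← integral_widthLaw_prod hp fun l t =>
      convolution f f (ContinuousLinearMap.mul ℝ ℝ) volume ((x - y) l / t)]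
  refine integral_congr_ae ?_
  filter_upwards [ae_widthLaw_pos hp] with w hw
  exact integral_uniformBox_estimator hf hw x y

theorem integrable_estimatorMatrix (hp : IsNonnegPDF p) (hf : IsBucketShape f)
    [IsFiniteMeasure (lshLaw p d)] (hF : eLpNorm (tensorPower f d) ∞ volume ≠ ∞)
    (x : Fin n → Fin d → ℝ) (i j : Fin n) :
    Integrable (fun θ => estimatorMatrix f x θ i j) (lshLaw p d) :=
  Integrable.of_bound (measurable_estimator hf (x i) (x j)).aestronglyMeasurable _
    ((ae_posSemidef_sub_estimatorMatrix hp hf hF x).mono fun θ hθ =>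
      (posSemidef_estimatorMatrix x θ).abs_apply_le hθ i j)

theorem expectation_estimatorMatrix (hp : IsNonnegPDF p) (hf : IsBucketShape f)
    [IsFiniteMeasure (lshLaw p d)] (hF : eLpNorm (tensorPower f d) ∞ volume ≠ ∞)
    (x : Fin n → Fin d → ℝ) :
    Matrix.expectation (lshLaw p d) (estimatorMatrix f x) = kernelMatrix f p x := by
  ext i j
  exact integral_estimator hp hf (integrable_estimatorMatrix hp hf hF x i j)

/-- For `n = 1` the sampling condition does not force `f^{⊗d}` to be bounded, so positivity is read
off from `(f * f)(0) = ∫ f² ≥ 0`. -/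
theorem posSemidef_kernelMatrix_one (hp : IsNonnegPDF p) (hf : IsBucketShape f)
    (x : Fin 1 → Fin d → ℝ) : (kernelMatrix f p x).PosSemidef := by
  have h : kernelMatrix f p x = Matrix.diagonal fun _ => kernel f p (0 : Fin d → ℝ) := by
    ext i j
    rw [Subsingleton.elim j i, Matrix.diagonal_apply_eq, kernelMatrix, Matrix.of_apply, sub_self]
  rw [h]
  refine Matrix.PosSemidef.diagonal fun _ => Finset.prod_nonneg fun l _ =>
    integral_nonneg fun w => mul_nonneg (hp.nonneg w) ?_
  rw [Pi.zero_apply, zero_div, convolution_def]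
  refine integral_nonneg fun t => ?_
  rw [ContinuousLinearMap.mul_apply', zero_sub, hf.even t]
  exact mul_self_nonneg _

theorem measurable_estimatorMatrix_average (hf : IsBucketShape f) (x : Fin n → Fin d → ℝ) (m : ℕ) :
    Measurable fun q : Fin m → (Fin d → ℝ) × (Fin d → ℝ) =>
      (1 / (m : ℝ)) • ∑ s, estimatorMatrix f x (q s) := by
  refine measurable_pi_lambda _ fun i => measurable_pi_lambda _ fun j => ?_
  simp only [Matrix.smul_apply, Matrix.sum_apply, smul_eq_mul]
  exact (Finset.measurable_fun_sum _ fun s _ =>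
    (measurable_estimator hf (x i) (x j)).comp (measurable_pi_apply s)).const_mul _

end KernelMatrix

/-! ### Whitening and the embedding property. -/

section Embedding

variable {n : ℕ}

/-- Congruence by `B` undoes the whitening and turns `ε • 1` into `ε • (K + lam • 1)`. -/
theorem loewnerLE_of_whitened {K A B D : Matrix (Fin n) (Fin n) ℝ} {lam ε : ℝ}
    (hK : K + lam • 1 = Bᴴ * B) (hDB : D * B = 1)
    (h₁ : (ε • 1 - (Dᴴ * A * D - Dᴴ * K * D)).PosSemidef)
    (h₂ : (ε • 1 + (Dᴴ * A * D - Dᴴ * K * D)).PosSemidef) :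
    LoewnerLE ((1 - ε) • (K + lam • 1)) (A + lam • 1) ∧
      LoewnerLE (A + lam • 1) ((1 + ε) • (K + lam • 1)) := by
  have hBD : Bᴴ * Dᴴ = 1 := by
    rw [← Matrix.conjTranspose_mul, hDB, Matrix.conjTranspose_one]
  have key : Bᴴ * (Dᴴ * A * D - Dᴴ * K * D) * B = A - K := by
    have : ∀ Z : Matrix (Fin n) (Fin n) ℝ, Bᴴ * (Dᴴ * Z * D) * B = Z := fun Z => by
      calc Bᴴ * (Dᴴ * Z * D) * B = (Bᴴ * Dᴴ) * Z * (D * B) := by simp only [Matrix.mul_assoc]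
        _ = Z := by rw [hBD, hDB, Matrix.one_mul, Matrix.mul_one]
    rw [Matrix.mul_sub, Matrix.sub_mul, this, this]
  have hε : Bᴴ * (ε • 1) * B = ε • (K + lam • 1) := by
    rw [hK, Matrix.mul_smul, Matrix.mul_one, Matrix.smul_mul]
  constructor
  · have h := h₂.conjTranspose_mul_mul_same B
    rw [Matrix.mul_add, Matrix.add_mul, key, hε] at h
    unfold LoewnerLE
    convert h using 1
    module
  · have h := h₁.conjTranspose_mul_mul_same B
    rw [Matrix.mul_sub, Matrix.sub_mul, key, hε] at h
    unfold LoewnerLE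
    convert h using 1
    module

theorem one_sub_le_map_apply {Ω E : Type*} [MeasurableSpace Ω] [MeasurableSpace E] {P : Measure Ω}
    [IsProbabilityMeasure P] {g : Ω → E} (hg : AEMeasurable g P) {S : Set E} {G : Set Ω} {δ : ℝ}
    (hG : P.real Gᶜ ≤ δ) (hGS : G ⊆ g ⁻¹' S) : ENNReal.ofReal (1 - δ) ≤ P.map g S := by
  refine le_trans ?_ ((measure_mono hGS).trans (Measure.le_map_apply hg S))
  rw [← ofReal_measureReal (measure_ne_top P G)]
  refine ENNReal.ofReal_le_ofReal ?_
  have h := measureReal_union_le (μ := P) G Gᶜ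
  rw [Set.union_compl_self, probReal_univ] at h
  linarith

theorem two_mul_mul_exp_neg_le {c n : ℕ} (hn : 2 ≤ n) {t : ℝ} (ht : (c + 2) * Real.log n ≤ t) :
    2 * (n * Real.exp (-t)) ≤ 1 / (n : ℝ) ^ c := by
  have hn2 : (2 : ℝ) ≤ n := by exact_mod_cast hn
  have hn0 : (0 : ℝ) < n := by linarith
  have h1 : Real.exp (-t) ≤ ((n : ℝ) ^ (c + 2))⁻¹ := by
    calc Real.exp (-t) ≤ Real.exp (-(((c + 2 : ℕ) : ℝ) * Real.log n)) :=
          Real.exp_le_exp.2 (by push_cast; linarith)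
      _ = ((n : ℝ) ^ (c + 2))⁻¹ := by rw [Real.exp_neg, Real.exp_nat_mul, Real.exp_log hn0]
  -- The factor `2` is absorbed by `2 ≤ n`; hence `c + 2` in the exponent.
  calc 2 * (n * Real.exp (-t)) ≤ n * (n * ((n : ℝ) ^ (c + 2))⁻¹) := by gcongr
    _ = 1 / (n : ℝ) ^ c := by rw [pow_add]; field_simp

end Embedding

/-- The embedding property for at least two points, given a bound `R` on the whitened summands. -/
theorem isOSE_of_bound {d n m : ℕ} (hm : 0 < m) (x : Fin n → Fin d → ℝ) {p f : ℝ → ℝ}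
    (hp : IsNonnegPDF p) (hf : IsBucketShape f) {lam ε R δ : ℝ} (hlam : 0 < lam) (hε : 0 < ε)
    (hF : eLpNorm (tensorPower f d) ∞ volume ≠ ∞) (hR : 0 < R)
    (hnR : n * (eLpNorm (tensorPower f d) ∞ volume).toReal ^ 2 ≤ R * lam)
    (hδ : 2 * (n * Real.exp (-(m * ε ^ 2 / (4 * R * (1 + ε))))) ≤ δ)
    {Ω : Type*} [MeasurableSpace Ω] (P : Measure Ω) [IsProbabilityMeasure P]
    (θ : Fin m → Ω → (Fin d → ℝ) × (Fin d → ℝ)) (hθ : ∀ s, HasLaw (θ s) (lshLaw p d) P)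
    (hind : iIndepFun θ P) :
    IsOSE ε δ lam (kernelMatrix f p x)
      (P.map fun ω => (1 / (m : ℝ)) • ∑ s, estimatorMatrix f x (θ s ω)) := by
  have : IsProbabilityMeasure (lshLaw p d) := (hθ ⟨0, hm⟩).isProbabilityMeasure_iff.1 inferInstance
  have hg : AEMeasurable (fun ω => (1 / (m : ℝ)) • ∑ s, estimatorMatrix f x (θ s ω)) P :=
    (measurable_estimatorMatrix_average hf x m).comp_aemeasurable
      (aemeasurable_pi_lambda _ fun s => (hθ s).aemeasurable)
  set K := kernelMatrix f p x with hKdef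
  have hEK : Matrix.expectation (lshLaw p d) (estimatorMatrix f x) = K :=
    expectation_estimatorMatrix hp hf hF x
  have hint := integrable_estimatorMatrix hp hf hF x
  have hK : K.PosSemidef := by
    rw [← hEK]
    exact Matrix.posSemidef_expectation hint
      (Filter.Eventually.of_forall fun θ => posSemidef_estimatorMatrix x θ)
  refine ⟨hK, Measure.isProbabilityMeasure_map hg, ?_⟩
  have hKpos : (K + lam • 1).PosDef := Matrix.PosDef.posSemidef_add hK (Matrix.PosDef.one.smul hlam)
  obtain ⟨B, hB⟩ := hKpos.posSemidef.exists_conjTranspose_mul_self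
  have hBunit : IsUnit B.det := by
    have h := (Matrix.isUnit_iff_isUnit_det _).1 hKpos.isUnit
    rw [hB, Matrix.det_mul] at h
    exact isUnit_of_mul_isUnit_right h
  set D := B⁻¹ with hD
  have hDB : D * B = 1 := Matrix.nonsing_inv_mul B hBunit
  have hBD : B * D = 1 := Matrix.mul_nonsing_inv B hBunit
  have hwhite : Dᴴ * (K + lam • 1) * D = 1 := by
    calc Dᴴ * (K + lam • 1) * D = (B * D)ᴴ * (B * D) := by
          rw [hB, Matrix.conjTranspose_mul]; simp only [Matrix.mul_assoc]
      _ = 1 := by rw [hBD, Matrix.conjTranspose_one, Matrix.one_mul]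
  let L : Matrix (Fin n) (Fin n) ℝ →ₗ[ℝ] Matrix (Fin n) (Fin n) ℝ :=
    LinearMap.mulRight ℝ D ∘ₗ LinearMap.mulLeft ℝ Dᴴ
  have hL : ∀ Z, L Z = Dᴴ * Z * D := fun Z => rfl
  have hEX : Matrix.expectation (lshLaw p d) (fun t => L (estimatorMatrix f x t)) = L K := by
    rw [Matrix.expectation_linearMap L hint, hEK]
  have hmeas : ∀ i j, Measurable fun t => L (estimatorMatrix f x t) i j := fun i j => by
    rw [funext fun t => Matrix.linearMap_apply_apply L (estimatorMatrix f x t) i j]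
    exact Finset.measurable_fun_sum _ fun k _ => Finset.measurable_fun_sum _ fun l _ =>
      (measurable_estimator hf (x k) (x l)).mul_const _
  have hXpos : ∀ t, (L (estimatorMatrix f x t)).PosSemidef := fun t =>
    (posSemidef_estimatorMatrix x t).conjTranspose_mul_mul_same D
  have hX : ∀ᵐ t ∂lshLaw p d, (L (estimatorMatrix f x t)).PosSemidef ∧
      (R • 1 - L (estimatorMatrix f x t)).PosSemidef := by
    filter_upwards [ae_posSemidef_sub_estimatorMatrix hp hf hF x] with t ht
    refine ⟨hXpos t, ?_⟩
    -- Before whitening, with `F` the sup norm: `R (K + λ) - K̃ = R K + (R λ - n F²) + (n F² - K̃)`.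
    have h := (((hK.smul hR.le).add (Matrix.PosSemidef.one.smul (sub_nonneg.2 hnR))).add
      ht).conjTranspose_mul_mul_same D
    convert h using 1
    have hRD : R • (1 : Matrix (Fin n) (Fin n) ℝ) = Dᴴ * (R • (K + lam • 1)) * D := by
      rw [Matrix.mul_smul, Matrix.smul_mul, hwhite]
    rw [hRD, hL, ← Matrix.sub_mul, ← Matrix.mul_sub]
    congr 2
    module
  have hM : (1 - Matrix.expectation (lshLaw p d)
      fun t => L (estimatorMatrix f x t)).PosSemidef := by
    have h := (Matrix.PosSemidef.one.smul hlam.le).conjTranspose_mul_mul_same D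
    convert h using 1
    rw [hEX, hL]
    conv_lhs => rw [← hwhite]
    rw [← Matrix.sub_mul, ← Matrix.mul_sub, add_sub_cancel_left]
  have hdev := Matrix.measureReal_deviation_le hθ hind hm hmeas (fun t => (hXpos t).1) hX hM hR hε
  rw [Fintype.card_fin, hEX] at hdev
  refine one_sub_le_map_apply hg (G := {ω |
    (ε • 1 - ((1 / (m : ℝ)) • ∑ s, L (estimatorMatrix f x (θ s ω)) - L K)).PosSemidef ∧
    (ε • 1 + ((1 / (m : ℝ)) • ∑ s, L (estimatorMatrix f x (θ s ω)) - L K)).PosSemidef})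
    (hdev.trans hδ) fun ω hω => ?_
  have hsum : (1 / (m : ℝ)) • ∑ s, L (estimatorMatrix f x (θ s ω)) =
      Dᴴ * ((1 / (m : ℝ)) • ∑ s, estimatorMatrix f x (θ s ω)) * D := by
    rw [← hL, map_smul, map_sum]
  rw [Set.mem_ofPred_eq, hsum, hL] at hω
  exact loewnerLE_of_whitened hB hDB hω.1 hω.2

end WLSH

/-! ### The main theorem. -/

theorem mainTheorem1 (c : ℕ) (ε₀ : ℝ) (hε₀ : 0 < ε₀) :
    ∃ C : ℝ, 0 < C ∧
      ∀ (d n m : ℕ), 0 < d → 0 < n → 0 < m →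
      ∀ (x : Fin n → Fin d → ℝ) (p f : ℝ → ℝ), WLSH.IsNonnegPDF p → WLSH.IsBucketShape f →
      ∀ (lam ε : ℝ), 0 < lam → 0 < ε → ε ≤ ε₀ →
      ENNReal.ofReal (C / ε ^ 2 * ((n : ℝ) / lam) * Real.log n) *
          eLpNorm (WLSH.tensorPower f d) ∞ volume ^ 2 ≤ (m : ℝ≥0∞) →
      ∀ (Ω : Type*) [MeasurableSpace Ω] (P : Measure Ω) [IsProbabilityMeasure P]
        (θ : Fin m → Ω → (Fin d → ℝ) × (Fin d → ℝ)),
      (∀ s, HasLaw (θ s) (WLSH.lshLaw p d) P) → iIndepFun θ P →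
      WLSH.IsOSE ε (1 / (n : ℝ) ^ c) lam (WLSH.kernelMatrix f p x)
        (P.map fun ω => (1 / (m : ℝ)) • ∑ s, WLSH.estimatorMatrix f x (θ s ω)) := by
  -- `4 (1 + ε₀)` pays for the Bernstein denominator `4 (1 + ε)`, and `c + 2` for the failure
  -- probability.
  refine ⟨4 * (1 + ε₀) * (c + 2), by positivity, ?_⟩
  intro d n m _ hn hm x p f hp hf lam ε hlam hε hεle hmC Ω _ P _ θ hθ hind
  -- For `n = 1` the allowed failure probability is `1`, so only positivity and measurability
  -- matter.
  obtain rfl | hn2 := (Nat.succ_le_of_lt hn).eq_or_lt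
  · refine ⟨WLSH.posSemidef_kernelMatrix_one hp hf x, Measure.isProbabilityMeasure_map
      ((WLSH.measurable_estimatorMatrix_average hf x m).comp_aemeasurable
        (aemeasurable_pi_lambda _ fun s => (hθ s).aemeasurable)), ?_⟩
    simp
  set C : ℝ := 4 * (1 + ε₀) * (c + 2) with hC
  have hC0 : 0 < C := by positivity
  have hn0 : (0 : ℝ) < n := by exact_mod_cast hn
  have hm0 : (0 : ℝ) < m := by exact_mod_cast hm
  have hlog : 0 < Real.log n := Real.log_pos (by exact_mod_cast hn2)
  set F := eLpNorm (WLSH.tensorPower f d) ∞ volume with hFdef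
  -- With `log n > 0`, an infinite norm would make the finite `m` at least `∞`.
  have hF : F ≠ ∞ := by
    intro h
    rw [h, ENNReal.top_pow two_ne_zero, ENNReal.mul_top
      (ENNReal.ofReal_pos.2 (by positivity)).ne'] at hmC
    exact ENNReal.natCast_ne_top m (top_le_iff.1 hmC)
  have hreal : C / ε ^ 2 * ((n : ℝ) / lam) * Real.log n * F.toReal ^ 2 ≤ m := by
    have h := ENNReal.toReal_mono (ENNReal.natCast_ne_top m) hmC
    rwa [ENNReal.toReal_mul, ENNReal.toReal_ofReal (by positivity), ENNReal.toReal_pow,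
      ENNReal.toReal_natCast] at h
  -- With this `R`, the requirement `n F² ≤ R λ` is the sampling condition rearranged, and the
  -- Bernstein exponent is `(c + 2) log n` times `(1 + ε₀) / (1 + ε) ≥ 1`.
  refine WLSH.isOSE_of_bound hm x hp hf hlam hε hF (R := m * ε ^ 2 / (C * Real.log n))
    (by positivity) ?_ (WLSH.two_mul_mul_exp_neg_le hn2 ?_) P θ hθ hind
  · calc n * F.toReal ^ 2 = C / ε ^ 2 * ((n : ℝ) / lam) * Real.log n * F.toReal ^ 2 *
          (ε ^ 2 * lam / (C * Real.log n)) := by field_simp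
      _ ≤ m * (ε ^ 2 * lam / (C * Real.log n)) := mul_le_mul_of_nonneg_right hreal (by positivity)
      _ = m * ε ^ 2 / (C * Real.log n) * lam := by ring
  · have h1 : m * ε ^ 2 / (4 * (m * ε ^ 2 / (C * Real.log n)) * (1 + ε)) =
        (c + 2) * Real.log n * ((1 + ε₀) / (1 + ε)) := by
      rw [hC]; field_simp
    rw [h1]
    refine le_mul_of_one_le_right (by positivity) ?_
    rw [one_le_div (by positivity)]
    linarith
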